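/- Let $E$ be a $\sigma$-Dedekind complete (real) Banach lattice, i.e. a Banach lattice in which every nonempty countable subset that is bounded above has a supremum, let $E^*$ be its dual Banach lattice, and let $p\ge 1$ be a real number. Terminology. A sequence $(u_n)_n$ in $E$ or in $E^*$ is disjoint if $|u_m|\wedge|u_n|=0$ whenever $m\neq n$. A sequence $(x_n)_n$ in $E$ is weakly $p$-summable if $\sum_n |x^*(x_n)|^p<\infty$ for every $x^*\in E^*$. A set $A\subseteq E$ is weakly $p$-compact if for every sequence $(x_n)_n$ in $A$ there are a subsequence $(x_{n_k})_k$ and a point $x\in A$ such that $(x_{n_k}-x)_k$ is weakly $p$-summable. A set $A\subseteq E$ is limited if every weak* null sequence in $E^*$ converges to $0$ uniformly on $A$; a bounded set $A\subseteq E$ is almost limited if every disjoint weak* null sequence in $E^*$ converges to $0$ uniformly on $A$. The Banach lattice $E$ has the $p$-weak $DP^*$ property if every weakly $p$-compact subset of $E$ is almost limited, and it has the disjoint Dunford–Pettis$^*$ property of order $p$ (disjoint $DP^*P_p$) if for every disjoint weakly $p$-summable sequence $(x_n)_n$ in $E$ the set $\{x_n : n\in\mathbb N\}$ is limited. Then: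 (a) If $E$ has the $p$-weak $DP^*$ property, then $E$ has the disjoint $DP^*P_p$. (b) If $p\ge 2$, then $E$ has the $p$-weak $DP^*$ property if and only if $E$ has the disjoint $DP^*P_p$. -/

import Mathlib

open Filter Topology

noncomputable section

set_option linter.unusedSectionVars false

/-! ### The lattice structure of the dual of a Banach lattice -/

namespace BanachLatticeDual

variable {E : Type*} [NormedAddCommGroup E] [Lattice E] [HasSolidNorm E] [IsOrderedAddMonoid E]
  [NormedSpace ℝ E]

/-- For `x ≥ 0` this is the value at `x` of the positive part of `f`:
`sup {f y : 0 ≤ y ≤ x}`. -/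
def posVal (f : StrongDual ℝ E) (x : E) : ℝ := sSup (f '' Set.Icc 0 x)

theorem le_norm_mul (f : StrongDual ℝ E) {x y : E} (hy : y ∈ Set.Icc 0 x) :
    f y ≤ ‖f‖ * ‖x‖ := by
  have h1 : ‖y‖ ≤ ‖x‖ := HasSolidNorm.solid (by
    rw [abs_of_nonneg hy.1, abs_of_nonneg (hy.1.trans hy.2)]; exact hy.2)
  calc f y ≤ ‖f y‖ := Real.le_norm_self _
    _ ≤ ‖f‖ * ‖y‖ := f.le_opNorm y
    _ ≤ ‖f‖ * ‖x‖ := by gcongr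

theorem bddAbove_image (f : StrongDual ℝ E) (x : E) : BddAbove (f '' Set.Icc 0 x) := by
  refine ⟨‖f‖ * ‖x‖, ?_⟩
  rintro _ ⟨y, hy, rfl⟩
  exact le_norm_mul f hy

theorem apply_le_posVal (f : StrongDual ℝ E) {x y : E} (h0 : 0 ≤ y) (h : y ≤ x) :
    f y ≤ posVal f x :=
  le_csSup (bddAbove_image f x) ⟨y, ⟨h0, h⟩, rfl⟩

theorem posVal_le (f : StrongDual ℝ E) {x : E} (hx : 0 ≤ x) {c : ℝ}
    (h : ∀ y, 0 ≤ y → y ≤ x → f y ≤ c) : posVal f x ≤ c := by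
  refine csSup_le ⟨f 0, 0, ⟨le_rfl, hx⟩, rfl⟩ ?_
  rintro _ ⟨y, hy, rfl⟩
  exact h y hy.1 hy.2

theorem posVal_nonneg (f : StrongDual ℝ E) {x : E} (hx : 0 ≤ x) : 0 ≤ posVal f x := by
  simpa using apply_le_posVal f le_rfl hx

theorem posVal_add (f : StrongDual ℝ E) {x y : E} (hx : 0 ≤ x) (hy : 0 ≤ y) :
    posVal f (x + y) = posVal f x + posVal f y := by
  apply le_antisymm
  · refine posVal_le f (add_nonneg hx hy) fun z hz hzxy => ?_
    have h1 : f (z ⊓ x) ≤ posVal f x := apply_le_posVal f (le_inf hz hx) inf_le_right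
    have h2 : f (z - z ⊓ x) ≤ posVal f y := by
      refine apply_le_posVal f (sub_nonneg.2 inf_le_left) ?_
      rw [sub_le_iff_le_add, add_inf]
      exact le_inf (le_add_of_nonneg_left hy) (by rwa [add_comm y x])
    have h3 : f z = f (z ⊓ x) + f (z - z ⊓ x) := by rw [← map_add]; congr 1; abel
    linarith
  · have h : ∀ a, 0 ≤ a → a ≤ x → f a ≤ posVal f (x + y) - posVal f y := by
      intro a ha hax
      have : posVal f y ≤ posVal f (x + y) - f a := by
        refine posVal_le f hy fun b hb hby => ?_
        have := apply_le_posVal f (add_nonneg ha hb) (add_le_add hax hby)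
        rw [map_add] at this
        linarith
      linarith
    linarith [posVal_le f hx h]

/-- Extension of `posVal f` from the positive cone to `E`. -/
def posFun (f : StrongDual ℝ E) (x : E) : ℝ := posVal f x⁺ - posVal f x⁻

theorem posFun_sub (f : StrongDual ℝ E) {a b : E} (ha : 0 ≤ a) (hb : 0 ≤ b) :
    posFun f (a - b) = posVal f a - posVal f b := by
  have h1 : a + (a - b)⁻ = b + (a - b)⁺ := by
    rw [← sub_eq_zero]
    have := posPart_sub_negPart (a - b)
    calc a + (a - b)⁻ - (b + (a - b)⁺) = (a - b) - ((a - b)⁺ - (a - b)⁻) := by abel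
      _ = 0 := by rw [this, sub_self]
  have h2 := congrArg (posVal f) h1
  rw [posVal_add f ha (negPart_nonneg _), posVal_add f hb (posPart_nonneg _)] at h2
  unfold posFun
  linarith

theorem posFun_of_nonneg (f : StrongDual ℝ E) {x : E} (hx : 0 ≤ x) :
    posFun f x = posVal f x := by
  unfold posFun
  have h0 : posVal f (0 : E) = 0 := by
    have := posVal_add f (le_refl (0 : E)) le_rfl
    rw [add_zero] at this
    linarith
  rw [posPart_of_nonneg hx, negPart_of_nonneg hx, h0, sub_zero]

theorem posFun_add (f : StrongDual ℝ E) (x y : E) :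
    posFun f (x + y) = posFun f x + posFun f y := by
  have h : x + y = (x⁺ + y⁺) - (x⁻ + y⁻) := by
    conv_lhs => rw [← posPart_sub_negPart x, ← posPart_sub_negPart y]
    abel
  rw [h, posFun_sub f (add_nonneg (posPart_nonneg _) (posPart_nonneg _))
    (add_nonneg (negPart_nonneg _) (negPart_nonneg _)),
    posVal_add f (posPart_nonneg _) (posPart_nonneg _),
    posVal_add f (negPart_nonneg _) (negPart_nonneg _)]
  unfold posFun
  ring

theorem norm_posFun_le (f : StrongDual ℝ E) (x : E) : ‖posFun f x‖ ≤ ‖f‖ * ‖x‖ := by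
  have key : ∀ z : E, 0 ≤ z → z ≤ |x| → posVal f z ≤ ‖f‖ * ‖x‖ := by
    intro z hz hzx
    refine posVal_le f hz fun y hy hyz => ?_
    have := le_norm_mul f ⟨hy, hyz.trans hzx⟩
    rwa [norm_abs_eq_norm] at this
  have h1 := key x⁺ (posPart_nonneg x) (sup_le (le_abs_self x) (abs_nonneg x))
  have h2 := key x⁻ (negPart_nonneg x) (sup_le (neg_le_abs x) (abs_nonneg x))
  have h3 := posVal_nonneg f (posPart_nonneg x)
  have h4 := posVal_nonneg f (negPart_nonneg x)
  rw [Real.norm_eq_abs, abs_le]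
  unfold posFun
  constructor <;> linarith

/-- The positive part `f⁺` of a bounded functional `f`, by the Riesz–Kantorovich formula. -/
def pos (f : StrongDual ℝ E) : StrongDual ℝ E :=
  let P : E →+ ℝ :=
    { toFun := posFun f
      map_zero' := by simpa using posFun_add f 0 0
      map_add' := posFun_add f }
  P.toRealLinearMap (AddMonoidHomClass.continuous_of_bound P ‖f‖ (norm_posFun_le f))

theorem pos_apply (f : StrongDual ℝ E) {x : E} (hx : 0 ≤ x) :
    pos f x = sSup (f '' Set.Icc 0 x) :=
  posFun_of_nonneg f hx

/-- The canonical order of the dual: `f ≤ g` iff `f x ≤ g x` for all `x ≥ 0`. -/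
instance instPartialOrder : PartialOrder (StrongDual ℝ E) where
  le f g := ∀ x : E, 0 ≤ x → f x ≤ g x
  le_refl _ _ _ := le_rfl
  le_trans _ _ _ h1 h2 x hx := (h1 x hx).trans (h2 x hx)
  le_antisymm f g h1 h2 := by
    ext x
    rw [← posPart_sub_negPart x, map_sub, map_sub,
      le_antisymm (h1 _ (posPart_nonneg x)) (h2 _ (posPart_nonneg x)),
      le_antisymm (h1 _ (negPart_nonneg x)) (h2 _ (negPart_nonneg x))]

theorem le_def {f g : StrongDual ℝ E} : f ≤ g ↔ ∀ x : E, 0 ≤ x → f x ≤ g x := Iff.rfl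

theorem le_pos (f : StrongDual ℝ E) : f ≤ pos f := fun x hx => by
  rw [pos_apply f hx]; exact apply_le_posVal f hx le_rfl

theorem zero_le_pos (f : StrongDual ℝ E) : 0 ≤ pos f := fun x hx => by
  rw [pos_apply f hx]; exact posVal_nonneg f hx

theorem pos_le {f g : StrongDual ℝ E} (h : f ≤ g) (h0 : 0 ≤ g) : pos f ≤ g := fun x hx => by
  rw [pos_apply f hx]
  refine posVal_le f hx fun y hy hyx => (h y hy).trans ?_
  have := h0 (x - y) (sub_nonneg.2 hyx)
  rw [map_sub] at this
  simpa using this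

/-- The dual of a Banach lattice is a vector lattice for its canonical order:
`f ⊔ g = f + (g - f)⁺` and `f ⊓ g = f - (f - g)⁺`. -/
instance instLattice : Lattice (StrongDual ℝ E) where
  __ := (instPartialOrder : PartialOrder (StrongDual ℝ E))
  sup f g := f + pos (g - f)
  inf f g := f - pos (f - g)
  le_sup_left f g x hx := by
    have := zero_le_pos (g - f) x hx
    simpa using this
  le_sup_right f g x hx := by
    have := le_pos (g - f) x hx
    simp only [sub_apply, add_apply] at this ⊢
    linarith
  sup_le f g h hf hg x hx := by
    have := pos_le (f := g - f) (g := h - f)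
      (fun y hy => by simpa using hg y hy) (fun y hy => by simpa using hf y hy) x hx
    simp only [sub_apply, add_apply] at this ⊢
    linarith
  inf_le_left f g x hx := by
    have := zero_le_pos (f - g) x hx
    simpa using this
  inf_le_right f g x hx := by
    have := le_pos (f - g) x hx
    simp only [sub_apply] at this ⊢
    linarith
  le_inf h f g hf hg x hx := by
    have := pos_le (f := f - g) (g := f - h)
      (fun y hy => sub_le_sub_left (hg y hy) (f y)) (fun y hy => sub_nonneg.2 (hf y hy)) x hx
    simp only [sub_apply] at this ⊢
    linarith

end BanachLatticeDual

/-! ### Notions for sequences and sets -/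

/-- A sequence in a vector lattice is disjoint if `|u m| ⊓ |u n| = 0` for `m ≠ n`. -/
def IsDisjointSeq {V : Type*} [Lattice V] [AddCommGroup V] (u : ℕ → V) : Prop :=
  ∀ m n : ℕ, m ≠ n → |u m| ⊓ |u n| = 0

/-- Every nonempty countable set that is bounded above has a supremum. -/
def IsSigmaDedekindComplete (E : Type*) [Lattice E] : Prop :=
  ∀ s : Set E, s.Nonempty → s.Countable → BddAbove s → ∃ a : E, IsLUB s a

section Banach

variable {E : Type*} [NormedAddCommGroup E] [NormedSpace ℝ E]

/-- `(x n)` is weakly `p`-summable if `∑ |f (x n)| ^ p < ∞` for every `f` in the dual. -/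
def IsWeaklyPSummable (p : ℝ) (x : ℕ → E) : Prop :=
  ∀ f : StrongDual ℝ E, Summable fun n => |f (x n)| ^ p

/-- Every sequence in `A` has a subsequence that is weakly `p`-convergent to a point `a` of `A`,
i.e. the differences with `a` form a weakly `p`-summable sequence. -/
def IsWeaklyPCompact (p : ℝ) (A : Set E) : Prop :=
  ∀ x : ℕ → E, (∀ n, x n ∈ A) →
    ∃ a ∈ A, ∃ φ : ℕ → ℕ, StrictMono φ ∧ IsWeaklyPSummable p fun n => x (φ n) - a

/-- Convergence to zero of a sequence of functionals in the weak* topology. -/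
def IsWeakStarNull (f : ℕ → StrongDual ℝ E) : Prop :=
  Tendsto (fun n => StrongDual.toWeakDual (f n)) atTop (𝓝 0)

/-- Every weak* null sequence of functionals converges to zero uniformly on `A`. -/
def IsLimitedSet (A : Set E) : Prop :=
  ∀ f : ℕ → StrongDual ℝ E, IsWeakStarNull f →
    TendstoUniformlyOn (fun n x => f n x) (fun _ => (0 : ℝ)) atTop A

end Banach

section BanachLattice

variable (E : Type*) [NormedAddCommGroup E] [Lattice E] [HasSolidNorm E] [IsOrderedAddMonoid E]
  [NormedSpace ℝ E]

variable {E} in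
/-- `A` is bounded and every disjoint weak* null sequence of functionals converges to zero
uniformly on `A`. -/
def IsAlmostLimitedSet (A : Set E) : Prop :=
  Bornology.IsBounded A ∧ ∀ f : ℕ → StrongDual ℝ E, IsDisjointSeq f → IsWeakStarNull f →
    TendstoUniformlyOn (fun n x => f n x) (fun _ => (0 : ℝ)) atTop A

/-- The `p`-weak DP* property: weakly `p`-compact sets are almost limited. -/
def HasPWeakDPStar (p : ℝ) : Prop :=
  ∀ A : Set E, IsWeaklyPCompact p A → IsAlmostLimitedSet A

/-- The disjoint Dunford–Pettis* property of order `p`: the set of terms of every disjoint weakly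
`p`-summable sequence is limited. -/
def HasDisjointDPStar (p : ℝ) : Prop :=
  ∀ x : ℕ → E, IsDisjointSeq x → IsWeaklyPSummable p x → IsLimitedSet (Set.range x)

end BanachLattice

end

set_option linter.unusedSectionVars false

/-! ### Disjoint elements of vector lattices -/

section LatticeGroup

variable {V : Type*} [Lattice V] [AddCommGroup V] [IsOrderedAddMonoid V]

/-! Both directions rest on one consequence of σ-Dedekind completeness: if `f n` is weak* null, then
`f n (z n) → 0` for every disjoint order bounded sequence `z`. Suprema of subfamilies of the `z n`
exist, `|f n|` of such a supremum is a superadditive set function, and Rosenthal's lemma isolates `z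
n` from the other terms.

(a) Let `x` be disjoint and weakly `p`-summable and `f` weak* null. Restrict `f n` to the band of `x
n` by `g n y = lim f n (y ⊓ k • |x n|)` for `y ≥ 0`. The `g n` are disjoint, agree with `f n` at `x
n`, and are weak* null by the fact above. Since `{0} ∪ {x n}` is weakly `p`-compact, it is almost
limited, so `f n (x n) = g n (x n) → 0`.

(b) For the converse, compactness reduces the claim to `f n (x n) → 0` for `f` disjoint and weak*
null and `x` weakly `p`-summable but not disjoint. The moduli `|f n|` are again weak* null. Hence
along a sparse subsequence one may subtract from `|x n|` large multiples of the earlier terms and a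
small multiple of a common majorant at little cost in `|f n|`, and the positive parts of what
remains are disjoint. A disjoint sequence dominated by a weakly `p`-summable one is itself weakly
`p`-summable when `p > 1` (averaging over signs, then Hölder duality), so the disjoint property
applies. This argument works for every `p > 1`; `p ≥ 2` is only needed to ensure that. -/

theorem inf_add_eq_zero_of_nonneg {a b c : V} (ha : 0 ≤ a) (hb : 0 ≤ b) (hc : 0 ≤ c)
    (hab : a ⊓ b = 0) (hac : a ⊓ c = 0) : a ⊓ (b + c) = 0 := by
  refine le_antisymm ?_ (le_inf ha (add_nonneg hb hc))
  have h1 : a ⊓ (b + c) - c ≤ a ⊓ b := by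
    refine le_inf ?_ ?_
    · exact (sub_le_self _ hc).trans inf_le_left
    · rw [sub_le_iff_le_add]; exact inf_le_right
  rw [hab, sub_nonpos] at h1
  exact (le_inf inf_le_left h1).trans hac.le

theorem inf_sum_eq_zero_of_nonneg {ι : Type*} (s : Finset ι) {a : V} {v : ι → V} (ha : 0 ≤ a)
    (hv : ∀ i ∈ s, 0 ≤ v i) (h : ∀ i ∈ s, a ⊓ v i = 0) : a ⊓ ∑ i ∈ s, v i = 0 := by
  classical
  induction s using Finset.induction_on with
  | empty => simpa using ha
  | insert i s hi ih =>
    rw [Finset.sum_insert hi]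
    have hv' : ∀ j ∈ s, 0 ≤ v j := fun j hj => hv j (Finset.mem_insert_of_mem hj)
    exact inf_add_eq_zero_of_nonneg ha (hv i (Finset.mem_insert_self i s)) (Finset.sum_nonneg hv')
      (h i (Finset.mem_insert_self i s)) (ih hv' fun j hj => h j (Finset.mem_insert_of_mem hj))

theorem add_le_of_inf_eq_zero {a b c : V} (h : a ⊓ b = 0) (ha : a ≤ c) (hb : b ≤ c) :
    a + b ≤ c := by
  rw [← inf_add_sup a b, h, zero_add]; exact sup_le ha hb

theorem sum_le_of_pairwise_inf_eq_zero {ι : Type*} (s : Finset ι) {v : ι → V} {u : V}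
    (hu : 0 ≤ u) (hv : ∀ i, 0 ≤ v i) (h : ∀ i j, i ≠ j → v i ⊓ v j = 0) (hvu : ∀ i, v i ≤ u) :
    ∑ i ∈ s, v i ≤ u := by
  classical
  induction s using Finset.induction_on with
  | empty => simpa using hu
  | insert i s hi ih =>
    rw [Finset.sum_insert hi]
    refine add_le_of_inf_eq_zero (inf_sum_eq_zero_of_nonneg s (hv i) (fun j _ => hv j) ?_)
      (hvu i) ih
    intro j hj
    exact h i j (by rintro rfl; exact hi hj)

theorem inf_eq_zero_of_le {a b c d : V} (ha : 0 ≤ a) (hb : 0 ≤ b) (hac : a ≤ c) (hbd : b ≤ d)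
    (h : c ⊓ d = 0) : a ⊓ b = 0 :=
  le_antisymm ((inf_le_inf hac hbd).trans h.le) (le_inf ha hb)

theorem IsDisjointSeq.of_abs_le {u v : ℕ → V} (hu : IsDisjointSeq u) (h : ∀ n, |v n| ≤ |u n|) :
    IsDisjointSeq v := fun m n hmn =>
  inf_eq_zero_of_le (abs_nonneg _) (abs_nonneg _) (h m) (h n) (hu m n hmn)

theorem IsDisjointSeq.comp_injective {u : ℕ → V} (hu : IsDisjointSeq u) {φ : ℕ → ℕ}
    (hφ : Function.Injective φ) : IsDisjointSeq (u ∘ φ) := fun _ _ hmn =>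
  hu _ _ (hφ.ne hmn)

theorem IsDisjointSeq.inf_eq_zero {u : ℕ → V} (hu : IsDisjointSeq u) (h0 : ∀ n, 0 ≤ u n)
    {m n : ℕ} (hmn : m ≠ n) : u m ⊓ u n = 0 := by
  have := hu m n hmn
  rwa [abs_of_nonneg (h0 m), abs_of_nonneg (h0 n)] at this

theorem isDisjointSeq_of_lt {u : ℕ → V} (h0 : ∀ n, 0 ≤ u n)
    (h : ∀ m n, m < n → u m ⊓ u n = 0) : IsDisjointSeq u := by
  intro m n hmn
  rw [abs_of_nonneg (h0 m), abs_of_nonneg (h0 n)]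
  rcases lt_or_gt_of_ne hmn with h1 | h1
  · exact h m n h1
  · rw [inf_comm]; exact h n m h1

variable [Module ℝ V] [IsOrderedModule ℝ V]

/-- With `z = v - (b / r) • w`, the first positive part is at most a multiple of `z⁺` (because `(b /
r) • w ≤ b • u`) and the second at most a multiple of `z⁻` (because `a ≥ r / b`), and `z⁺ ⊓ z⁻ = 0`.
-/
theorem posPart_sub_smul_inf_posPart_sub_smul {u v w : V} {a b r : ℝ} (hv : 0 ≤ v) (hb : 0 < b)
    (hr : 0 < r) (hw : w ≤ r • u) (hrb : r / b ≤ a) : (v - b • u)⁺ ⊓ (w - a • v)⁺ = 0 := by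
  refine le_antisymm ?_ (le_inf (posPart_nonneg _) (posPart_nonneg _))
  set K : ℝ := max 1 (r / b) with hK
  have hK1 : 1 ≤ K := le_max_left _ _
  have hK0 : 0 < K := by linarith
  set z : V := v - (b / r) • w with hz
  have h1 : (v - b • u)⁺ ≤ K • z⁺ := by
    have hz1 : (v - b • u)⁺ ≤ z⁺ := by
      refine posPart_mono ?_
      rw [hz]
      refine sub_le_sub_left ?_ _
      calc (b / r) • w ≤ (b / r) • r • u := by gcongr
        _ = b • u := by rw [smul_smul, div_mul_cancel₀ _ hr.ne']
    refine hz1.trans ?_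
    calc z⁺ = (1 : ℝ) • z⁺ := (one_smul _ _).symm
      _ ≤ K • z⁺ := smul_le_smul_of_nonneg_right hK1 (posPart_nonneg _)
  have h2 : (w - a • v)⁺ ≤ K • z⁻ := by
    have h3 : (r / b) • z⁻ ≤ K • z⁻ :=
      smul_le_smul_of_nonneg_right (le_max_right _ _) (negPart_nonneg _)
    refine le_trans (sup_le ?_ ?_) h3
    · calc w - a • v ≤ w - (r / b) • v := by gcongr
        _ = (r / b) • (-z) := by
          rw [hz, neg_sub, smul_sub, smul_smul, div_mul_div_cancel₀ hb.ne', div_self hr.ne',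
            one_smul]
        _ ≤ (r / b) • z⁻ := by gcongr; exact neg_le_negPart z
    · exact smul_nonneg (by positivity) (negPart_nonneg _)
  have h3 : K⁻¹ • ((v - b • u)⁺ ⊓ (w - a • v)⁺) ≤ z⁺ ⊓ z⁻ := by
    refine le_inf ?_ ?_
    · rw [inv_smul_le_iff_of_pos hK0]; exact inf_le_left.trans h1
    · rw [inv_smul_le_iff_of_pos hK0]; exact inf_le_right.trans h2
  rw [posPart_inf_negPart_eq_zero, inv_smul_le_iff_of_pos hK0, smul_zero] at h3
  exact h3

/-- Disjointification: in a pair `i < k`, the multiple of `u` removed from `v i` and the multiple of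
`v i` removed from `v k` make the two remainders disjoint. -/
theorem isDisjointSeq_posPart_sub_sum {u : V} {v : ℕ → V} {a b r : ℕ → ℝ} (hu : 0 ≤ u)
    (hv : ∀ k, 0 ≤ v k) (ha : ∀ k, 0 ≤ a k) (hb : ∀ k, 0 < b k) (hr : ∀ k, 0 < r k)
    (hvu : ∀ k, v k ≤ r k • u)
    (hab : ∀ i k, i < k → r k / b i ≤ a k) :
    IsDisjointSeq fun k => (v k - a k • ∑ i ∈ Finset.range k, v i - b k • u)⁺ := by
  refine isDisjointSeq_of_lt (fun _ => posPart_nonneg _) fun i k hik => ?_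
  refine inf_eq_zero_of_le (posPart_nonneg _) (posPart_nonneg _)
    (posPart_mono ?_) (posPart_mono ?_) (posPart_sub_smul_inf_posPart_sub_smul (hv i) (hb i) (hr k)
      (hvu k) (hab i k hik))
  · rw [sub_right_comm]
    exact sub_le_self _ (smul_nonneg (ha i) (Finset.sum_nonneg fun j _ => hv j))
  · refine (sub_le_self _ (smul_nonneg (hb k).le hu)).trans (sub_le_sub_left ?_ _)
    have : v i ≤ ∑ j ∈ Finset.range k, v j :=
      Finset.single_le_sum (fun j _ => hv j) (Finset.mem_range.2 hik)
    exact smul_le_smul_of_nonneg_left this (ha k)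

end LatticeGroup

/-! ### Rosenthal's disjointification lemma -/

theorem exists_partition_infinite {S : Set ℕ} (hS : S.Infinite) :
    ∃ N : ℕ → Set ℕ, (∀ p, (N p).Infinite) ∧ (∀ p, N p ⊆ S) ∧
      ∀ p q n, n ∈ N p → n ∈ N q → p = q := by
  have := hS.to_subtype
  let e := Nat.Subtype.orderIsoOfNat S
  refine ⟨fun p => Set.range fun k => (e (Nat.pair p k) : ℕ), ?_, ?_, ?_⟩
  · intro p
    refine Set.infinite_range_of_injective fun k l hkl => ?_
    have := e.injective (Subtype.ext hkl)
    simpa using (Nat.pair_eq_pair.1 this).2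
  · rintro p _ ⟨k, rfl⟩
    exact (e _).2
  · rintro p q n ⟨k, rfl⟩ ⟨l, hl⟩
    have := e.injective (Subtype.ext hl)
    exact ((Nat.pair_eq_pair.1 this).1).symm

/-- Split `S` into infinitely many infinite pieces. If every piece has a bad index, the set of these
indices is infinite and, by superadditivity, each of its members gives it mass at least `ε` less
than it gave `S`. The masses are bounded by `C`, so this stops after about `C / ε` rounds. -/
theorem exists_infinite_forall_diff_singleton_lt {μ : ℕ → Set ℕ → ℝ} {C ε : ℝ} (hε : 0 < ε)
    (h0 : ∀ n A, 0 ≤ μ n A)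
    (hadd : ∀ n A B D, Disjoint A B → A ⊆ D → B ⊆ D → μ n A + μ n B ≤ μ n D)
    (hC : ∀ n, μ n Set.univ ≤ C) :
    ∃ M : Set ℕ, M.Infinite ∧ ∀ n ∈ M, μ n (M \ {n}) < ε := by
  have mono : ∀ n A D, A ⊆ D → μ n A ≤ μ n D := fun n A D h => by
    have := hadd n A ∅ D (Set.disjoint_empty _) h (Set.empty_subset _)
    linarith [h0 n ∅]
  have key : ∀ k : ℕ, ∀ S : Set ℕ, S.Infinite → (∀ n ∈ S, μ n S ≤ k * ε) →
      ∃ M : Set ℕ, M.Infinite ∧ ∀ n ∈ M, μ n (M \ {n}) < ε := by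
    intro k
    induction k with
    | zero =>
      intro S hS h
      refine ⟨S, hS, fun n hn => ?_⟩
      have := mono n (S \ {n}) S Set.sdiff_subset
      have h2 := h n hn
      simp only [Nat.cast_zero, zero_mul] at h2
      linarith
    | succ k ih =>
      intro S hS h
      obtain ⟨N, hN, hNS, hdisj⟩ := exists_partition_infinite hS
      by_cases hp : ∃ p, ∀ n ∈ N p, μ n (N p \ {n}) < ε
      · obtain ⟨p, hp⟩ := hp
        exact ⟨N p, hN p, hp⟩
      · push Not at hp
        choose m hm hmε using hp
        have hinj : Function.Injective m := fun p q hpq => hdisj p q (m p) (hm p) (hpq ▸ hm q)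
        refine ih (Set.range m) (Set.infinite_range_of_injective hinj) ?_
        rintro _ ⟨p, rfl⟩
        have h1 := hadd (m p) (Set.range m) (N p \ {m p}) S ?_ ?_ (Set.sdiff_subset.trans (hNS p))
        · have h2 := h (m p) (hNS p (hm p))
          have h3 := hmε p
          push_cast at h2
          linarith
        · rw [Set.disjoint_left]
          rintro _ ⟨q, rfl⟩ ⟨h1, h2⟩
          exact h2 (by rw [hdisj q p _ (hm q) h1]; rfl)
        · rintro _ ⟨q, rfl⟩
          exact hNS q (hm q)
  obtain ⟨k, hk⟩ := exists_nat_ge (C / ε)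
  refine key k Set.univ Set.infinite_univ fun n _ => (hC n).trans ?_
  rwa [div_le_iff₀ hε] at hk

/-! ### The dual of a Banach lattice -/

namespace BanachLatticeDual

variable {E : Type*} [NormedAddCommGroup E] [Lattice E] [HasSolidNorm E] [IsOrderedAddMonoid E]
  [NormedSpace ℝ E]

instance instIsOrderedAddMonoid : IsOrderedAddMonoid (StrongDual ℝ E) where
  add_le_add_left f g h k x hx := by
    have := h x hx
    simp only [add_apply]
    linarith

theorem apply_mono {h : StrongDual ℝ E} (hh : 0 ≤ h) {x y : E} (hxy : x ≤ y) : h x ≤ h y := by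
  have := hh (y - x) (sub_nonneg.2 hxy)
  rw [map_sub] at this
  simpa using this

theorem apply_nonneg {h : StrongDual ℝ E} (hh : 0 ≤ h) {x : E} (hx : 0 ≤ x) : 0 ≤ h x := by
  simpa using apply_mono hh hx

theorem abs_apply_le (f : StrongDual ℝ E) (x : E) : |f x| ≤ |f| |x| := by
  have h0 : (0 : StrongDual ℝ E) ≤ |f| := abs_nonneg f
  have key : ∀ z : E, 0 ≤ z → |f z| ≤ |f| z := fun z hz => by
    have h1 := (le_abs_self f : f ≤ |f|) z hz
    have h2 := (neg_le_abs f : -f ≤ |f|) z hz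
    rw [neg_apply] at h2
    exact abs_le.2 ⟨by linarith, h1⟩
  calc |f x| = |f x⁺ - f x⁻| := by rw [← map_sub, posPart_sub_negPart]
    _ ≤ |f x⁺| + |f x⁻| := abs_sub _ _
    _ ≤ |f| x⁺ + |f| x⁻ := add_le_add (key _ (posPart_nonneg x)) (key _ (negPart_nonneg x))
    _ = |f| |x| := by rw [← map_add, posPart_add_negPart]

/-- One half of `|f| x = sup {f z : |z| ≤ x}`: it trades the modulus for a signed value at a
dominated vector. -/
theorem exists_abs_le_lt_apply (f : StrongDual ℝ E) {x : E} (hx : 0 ≤ x) {δ : ℝ} (hδ : 0 < δ) :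
    ∃ z : E, |z| ≤ x ∧ |f| x - δ < f z := by
  -- By definition `|f| = f ⊔ -f = f + (-f - f)⁺`. If `y` nearly attains the supremum, then `z = x -
  -- 2y` nearly attains `|f| x`.
  have h1 : |f| x = f x + sSup ((-f - f : StrongDual ℝ E) '' Set.Icc 0 x) := by
    rw [← pos_apply _ hx]; rfl
  obtain ⟨_, ⟨y, hy, rfl⟩, hlt⟩ := exists_lt_of_lt_csSup
    (s := (-f - f : StrongDual ℝ E) '' Set.Icc 0 x) ⟨_, 0, ⟨le_rfl, hx⟩, rfl⟩
    (sub_lt_self (sSup ((-f - f : StrongDual ℝ E) '' Set.Icc 0 x)) hδ)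
  refine ⟨x - y - y, sup_le ?_ ?_, ?_⟩
  · exact (sub_le_self _ hy.1).trans (sub_le_self _ hy.1)
  · rw [neg_sub]
    exact (sub_le_self _ (sub_nonneg.2 hy.2)).trans hy.2
  · rw [h1]
    simp only [sub_apply, neg_apply, map_sub] at hlt ⊢
    linarith

theorem abs_apply_le_norm_mul (f : StrongDual ℝ E) {x : E} (hx : 0 ≤ x) :
    |f| x ≤ ‖f‖ * ‖x‖ := by
  refine le_of_forall_pos_le_add fun δ hδ => ?_
  obtain ⟨z, hz, hlt⟩ := exists_abs_le_lt_apply f hx hδ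
  have h1 : ‖z‖ ≤ ‖x‖ := HasSolidNorm.solid (by rwa [abs_of_nonneg hx])
  have h2 : f z ≤ ‖f‖ * ‖x‖ := (Real.le_norm_self _).trans (f.le_opNorm_of_le h1)
  linarith

/-- Since `f ⊓ g = f - (f - g)⁺`, a near maximiser `y` of `f - g` on `[0, x]` splits `x` into a part
almost invisible to `g` and a part almost invisible to `f`. -/
theorem exists_add_lt_of_inf_eq_zero {f g : StrongDual ℝ E} (h : f ⊓ g = 0) {x : E} (hx : 0 ≤ x)
    {δ : ℝ} (hδ : 0 < δ) : ∃ y : E, 0 ≤ y ∧ y ≤ x ∧ f (x - y) + g y < δ := by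
  have h1 : f x - sSup ((f - g : StrongDual ℝ E) '' Set.Icc 0 x) = 0 := by
    rw [← pos_apply _ hx]
    exact DFunLike.congr_fun h x
  obtain ⟨_, ⟨y, hy, rfl⟩, hlt⟩ := exists_lt_of_lt_csSup
    (s := (f - g : StrongDual ℝ E) '' Set.Icc 0 x) ⟨_, 0, ⟨le_rfl, hx⟩, rfl⟩
    (sub_lt_self (sSup ((f - g : StrongDual ℝ E) '' Set.Icc 0 x)) hδ)
  refine ⟨y, hy.1, hy.2, ?_⟩
  rw [sub_apply] at hlt
  rw [map_sub]
  linarith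

end BanachLatticeDual

/-! ### Weak* null and weakly `p`-summable sequences -/

section Sequences

variable {E : Type*} [NormedAddCommGroup E] [NormedSpace ℝ E]

theorem isWeakStarNull_iff {f : ℕ → StrongDual ℝ E} :
    IsWeakStarNull f ↔ ∀ x, Tendsto (fun n => f n x) atTop (𝓝 0) := by
  unfold IsWeakStarNull
  rw [tendsto_iff_forall_eval_tendsto_topDualPairing]
  rfl

theorem IsWeakStarNull.comp_strictMono {f : ℕ → StrongDual ℝ E} (hf : IsWeakStarNull f)
    {φ : ℕ → ℕ} (hφ : StrictMono φ) : IsWeakStarNull (f ∘ φ) :=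
  isWeakStarNull_iff.2 fun x => (isWeakStarNull_iff.1 hf x).comp hφ.tendsto_atTop

theorem IsWeakStarNull.exists_norm_le [CompleteSpace E] {f : ℕ → StrongDual ℝ E}
    (hf : IsWeakStarNull f) : ∃ C, 0 < C ∧ ∀ n, ‖f n‖ ≤ C := by
  obtain ⟨C, hC⟩ := banach_steinhaus (g := f) fun x => by
    obtain ⟨C, hC⟩ := (isWeakStarNull_iff.1 hf x).norm.bddAbove_range
    exact ⟨C, fun n => hC ⟨n, rfl⟩⟩
  exact ⟨max C 1, by positivity, fun n => (hC n).trans (le_max_left _ _)⟩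

/-- Uniform boundedness on the dual, which is always complete, applied to the images of `x i` in the
bidual. -/
theorem exists_norm_le_of_forall_dual_bounded {ι : Type*} {x : ι → E}
    (h : ∀ f : StrongDual ℝ E, ∃ C, ∀ i, |f (x i)| ≤ C) : ∃ C, ∀ i, ‖x i‖ ≤ C := by
  obtain ⟨C, hC⟩ := banach_steinhaus (g := fun i => NormedSpace.inclusionInDoubleDualLi ℝ (x i))
    fun f => h f
  exact ⟨C, fun i => by simpa only [LinearIsometry.norm_map] using hC i⟩

theorem IsWeaklyPSummable.comp_injective {p : ℝ} {x : ℕ → E} (hx : IsWeaklyPSummable p x)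
    {φ : ℕ → ℕ} (hφ : Function.Injective φ) : IsWeaklyPSummable p (x ∘ φ) := fun f =>
  (hx f).comp_injective hφ

theorem IsWeaklyPSummable.exists_norm_le {p : ℝ} (hp : 0 < p) {x : ℕ → E}
    (hx : IsWeaklyPSummable p x) : ∃ C, ∀ n, ‖x n‖ ≤ C := by
  refine exists_norm_le_of_forall_dual_bounded fun f => ?_
  obtain ⟨C, hC⟩ := (hx f).tendsto_atTop_zero.bddAbove_range
  refine ⟨C ^ p⁻¹, fun n => ?_⟩
  rw [Real.le_rpow_inv_iff_of_pos (abs_nonneg _) ((by positivity : (0 : ℝ) ≤ _).trans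
    (hC ⟨n, rfl⟩)) hp]
  exact hC ⟨n, rfl⟩

theorem exists_strictMono_le_of_not_tendstoUniformlyOn {f : ℕ → StrongDual ℝ E}
    {A : Set E} (h : ¬ TendstoUniformlyOn (fun n x => f n x) (fun _ => (0 : ℝ)) atTop A) :
    ∃ ε > 0, ∃ φ : ℕ → ℕ, StrictMono φ ∧ ∃ a : ℕ → E, ∀ k, a k ∈ A ∧ ε ≤ |f (φ k) (a k)| := by
  rw [Metric.tendstoUniformlyOn_iff] at h
  push Not at h
  obtain ⟨ε, hε, h⟩ := h
  obtain ⟨φ, hφ, hφ'⟩ := extraction_of_frequently_atTop h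
  choose a ha ha' using hφ'
  refine ⟨ε, hε, φ, hφ, a, fun k => ⟨ha k, ?_⟩⟩
  simpa [Real.dist_eq] using ha' k

/-- Limitedness of the range of a sequence can be tested along the diagonals of its subsequences. -/
theorem isLimitedSet_range {x : ℕ → E}
    (h : ∀ f : ℕ → StrongDual ℝ E, IsWeakStarNull f → ∀ φ : ℕ → ℕ, StrictMono φ →
      Tendsto (fun n => f n (x (φ n))) atTop (𝓝 0)) : IsLimitedSet (Set.range x) := by
  intro f hf
  by_contra hcon
  obtain ⟨ε, hε, φ, hφ, a, ha⟩ := exists_strictMono_le_of_not_tendstoUniformlyOn hcon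
  choose ha' haε using ha
  choose m hm using ha'
  have hf' : ∀ j, ∀ᶠ k in atTop, |f (φ k) (x j)| < ε := fun j => by
    have := (isWeakStarNull_iff.1 (hf.comp_strictMono hφ) (x j)).abs
    rw [abs_zero] at this
    exact this.eventually (gt_mem_nhds hε)
  -- A bounded range of indices meets only finitely many `k`, since the functionals tend to zero at
  -- each single `x j`.
  have hmt : Tendsto m atTop atTop := by
    refine tendsto_atTop.2 fun b => ?_
    filter_upwards [(Finset.eventually_all (Finset.range b)).2 fun j _ => hf' j] with k hk
    by_contra hlt
    have h2 := haε k
    rw [← hm] at h2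
    exact absurd (hk (m k) (Finset.mem_range.2 (not_le.1 hlt))) (not_lt.2 h2)
  obtain ⟨ψ, hψ, hψm⟩ := strictMono_subseq_of_tendsto_atTop hmt
  have h1 := h _ (hf.comp_strictMono (hφ.comp hψ)) _ hψm
  obtain ⟨k, hk⟩ := ((h1.abs.eventually (gt_mem_nhds (by simpa using hε : |(0:ℝ)| < ε)))).exists
  have h2 := haε (ψ k)
  rw [← hm] at h2
  exact absurd hk (not_lt.2 h2)

end Sequences

theorem tendsto_zero_of_forall_subseq {u : ℕ → ℝ}
    (h : ∀ ε > 0, ∀ φ : ℕ → ℕ, StrictMono φ → ¬ ∀ k, ε ≤ |u (φ k)|) :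
    Tendsto u atTop (𝓝 0) := by
  rw [Metric.tendsto_nhds]
  by_contra hcon
  push Not at hcon
  obtain ⟨ε, hε, hfr⟩ := hcon
  obtain ⟨φ, hφ, hφ'⟩ := extraction_of_frequently_atTop hfr
  exact h ε hε φ hφ fun k => by simpa [Real.dist_eq] using hφ' k

/-! ### Weak* null sequences on disjoint order bounded sequences -/

section OrderBounded

open BanachLatticeDual

variable {E : Type*} [NormedAddCommGroup E] [Lattice E] [HasSolidNorm E] [IsOrderedAddMonoid E]
  [NormedSpace ℝ E] [CompleteSpace E]

/-- Rosenthal's lemma for `μ n A = |f n| (sup of z over A)` gives an infinite `M` on which `z n`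
carries all but `ε / 2` of the supremum over `M`. That supremum is one fixed vector, so `f n` tends
to zero there. -/
theorem not_forall_le_abs_apply_of_disjoint (hE : IsSigmaDedekindComplete E)
    {f : ℕ → StrongDual ℝ E} (hf : IsWeakStarNull f) {x : E} {z : ℕ → E}
    (hz : IsDisjointSeq z) (h0 : ∀ n, 0 ≤ z n) (hzx : ∀ n, z n ≤ x) {ε : ℝ} (hε : 0 < ε) :
    ¬ ∀ n, ε ≤ |f n (z n)| := by
  intro hle
  have hx : 0 ≤ x := (h0 0).trans (hzx 0)
  -- The element `0` is inserted so that the empty index set also has a supremum.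
  have hlub : ∀ A : Set ℕ, ∃ a, IsLUB (insert 0 (z '' A)) a := fun A =>
    hE _ (Set.insert_nonempty _ _) ((A.to_countable.image z).insert 0) ⟨x, by
      rintro _ (rfl | ⟨n, -, rfl⟩)
      exacts [hx, hzx n]⟩
  choose Z hZ using hlub
  have hZ0 : ∀ A, 0 ≤ Z A := fun A => (hZ A).1 (Set.mem_insert _ _)
  have hZle : ∀ {A : Set ℕ} {n}, n ∈ A → z n ≤ Z A := fun {A n} hn =>
    (hZ A).1 (Set.mem_insert_of_mem _ ⟨n, hn, rfl⟩)
  have hleZ : ∀ {A : Set ℕ} {c : E}, 0 ≤ c → (∀ n ∈ A, z n ≤ c) → Z A ≤ c := fun {A c} hc h =>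
    (hZ A).2 (by
      rintro _ (rfl | ⟨n, hn, rfl⟩)
      exacts [hc, h n hn])
  have hZmono : ∀ {A D : Set ℕ}, A ⊆ D → Z A ≤ Z D := fun h =>
    hleZ (hZ0 _) fun n hn => hZle (h hn)
  have hZadd : ∀ A B D : Set ℕ, Disjoint A B → A ⊆ D → B ⊆ D → Z A + Z B ≤ Z D := by
    intro A B D hAB hA hB
    rw [← le_sub_iff_add_le]
    refine hleZ (sub_nonneg.2 (hZmono hB)) fun i hi => ?_
    rw [le_sub_comm]
    refine hleZ (sub_nonneg.2 (hZle (hA hi))) fun j hj => ?_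
    rw [le_sub_iff_add_le]
    refine add_le_of_inf_eq_zero (hz.inf_eq_zero h0 ?_) (hZle (hB hj)) (hZle (hA hi))
    rintro rfl
    exact Set.disjoint_left.1 hAB hi hj
  obtain ⟨C, hC, hfC⟩ := hf.exists_norm_le
  obtain ⟨M, hM, hMε⟩ := exists_infinite_forall_diff_singleton_lt
    (μ := fun n A => |f n| (Z A)) (C := C * ‖x‖) (ε := ε / 2) (by positivity)
    (fun n A => apply_nonneg (abs_nonneg _) (hZ0 A))
    (fun n A B D hAB hA hB => by
      rw [← map_add]
      exact apply_mono (abs_nonneg _) (hZadd A B D hAB hA hB))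
    (fun n => by
      have h1 : |f n| (Z Set.univ) ≤ |f n| x :=
        apply_mono (abs_nonneg _) (hleZ hx fun n _ => hzx n)
      refine h1.trans ((abs_apply_le_norm_mul (f n) hx).trans ?_)
      exact mul_le_mul_of_nonneg_right (hfC n) (norm_nonneg _))
  have hev : ∀ᶠ n in atTop, |f n (Z M)| < ε / 2 :=
    (isWeakStarNull_iff.1 hf (Z M)).abs.eventually (gt_mem_nhds (by simpa using half_pos hε))
  obtain ⟨n, hnM, hn⟩ := ((Nat.frequently_atTop_iff_infinite.2 hM).and_eventually hev).exists
  have hsplit : Z M = z n + Z (M \ {n}) := by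
    apply le_antisymm
    · refine hleZ (add_nonneg (h0 n) (hZ0 _)) fun i hi => ?_
      by_cases hin : i = n
      · rw [hin]; exact le_add_of_nonneg_right (hZ0 _)
      · exact (hZle (A := M \ {n}) ⟨hi, hin⟩).trans (le_add_of_nonneg_left (h0 n))
    · rw [← le_sub_iff_add_le']
      refine hleZ (sub_nonneg.2 (hZle hnM)) fun j hj => ?_
      rw [le_sub_iff_add_le]
      exact add_le_of_inf_eq_zero (hz.inf_eq_zero h0 hj.2) (hZle hj.1) (hZle hnM)
  have h1 : f n (z n) = f n (Z M) - f n (Z (M \ {n})) := by rw [hsplit, map_add]; ring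
  have h2 : |f n (Z (M \ {n}))| ≤ |f n| (Z (M \ {n})) := by
    have := abs_apply_le (f n) (Z (M \ {n}))
    rwa [abs_of_nonneg (hZ0 _)] at this
  have h3 := abs_sub (f n (Z M)) (f n (Z (M \ {n})))
  have h4 := hle n
  have h5 := hMε n hnM
  rw [h1] at h4
  linarith

theorem tendsto_apply_of_disjoint_of_nonneg (hE : IsSigmaDedekindComplete E)
    {f : ℕ → StrongDual ℝ E} (hf : IsWeakStarNull f) {x : E} {z : ℕ → E}
    (hz : IsDisjointSeq z) (h0 : ∀ n, 0 ≤ z n) (hzx : ∀ n, z n ≤ x) :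
    Tendsto (fun n => f n (z n)) atTop (𝓝 0) :=
  tendsto_zero_of_forall_subseq fun _ hε _ hφ =>
    not_forall_le_abs_apply_of_disjoint hE (hf.comp_strictMono hφ)
      (hz.comp_injective hφ.injective) (fun _ => h0 _) (fun _ => hzx _) hε

theorem tendsto_apply_of_disjoint_of_abs_le (hE : IsSigmaDedekindComplete E)
    {f : ℕ → StrongDual ℝ E} (hf : IsWeakStarNull f) {x : E} {z : ℕ → E}
    (hz : IsDisjointSeq z) (hzx : ∀ n, |z n| ≤ x) :
    Tendsto (fun n => f n (z n)) atTop (𝓝 0) := by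
  have hp : ∀ n, (z n)⁺ ≤ |z n| := fun n => sup_le (le_abs_self _) (abs_nonneg _)
  have hn : ∀ n, (z n)⁻ ≤ |z n| := fun n => sup_le (neg_le_abs _) (abs_nonneg _)
  have h1 := tendsto_apply_of_disjoint_of_nonneg hE hf (z := fun n => (z n)⁺)
    (hz.of_abs_le fun n => by rw [abs_of_nonneg (posPart_nonneg _)]; exact hp n)
    (fun n => posPart_nonneg _) (fun n => (hp n).trans (hzx n))
  have h2 := tendsto_apply_of_disjoint_of_nonneg hE hf (z := fun n => (z n)⁻)
    (hz.of_abs_le fun n => by rw [abs_of_nonneg (negPart_nonneg _)]; exact hn n)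
    (fun n => negPart_nonneg _) (fun n => (hn n).trans (hzx n))
  have h3 := h1.sub h2
  simp only [← map_sub, posPart_sub_negPart, sub_zero] at h3
  exact h3

end OrderBounded

/-! ### Restricting functionals to principal bands -/

namespace BanachLatticeDual

variable {E : Type*} [NormedAddCommGroup E] [Lattice E] [HasSolidNorm E] [IsOrderedAddMonoid E]
  [NormedSpace ℝ E]

/-- Extend by `x ↦ L x⁺ - L x⁻`; real homogeneity need not be assumed, because an additive
continuous map is real linear. -/
theorem exists_strongDual_of_additive_on_cone {L : E → ℝ} {C : ℝ}
    (hadd : ∀ x y, 0 ≤ x → 0 ≤ y → L (x + y) = L x + L y)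
    (hL : ∀ x, 0 ≤ x → |L x| ≤ C * ‖x‖) : ∃ g : StrongDual ℝ E, ∀ x, 0 ≤ x → g x = L x := by
  have h0 : L 0 = 0 := by
    have := hadd 0 0 le_rfl le_rfl
    rw [add_zero] at this
    linarith
  have hC : ∀ x : E, 0 ≤ C * ‖x‖ := fun x => by
    have := (abs_nonneg _).trans (hL |x| (abs_nonneg x))
    rwa [norm_abs_eq_norm] at this
  have hsub : ∀ x y a b : E, 0 ≤ x → 0 ≤ y → 0 ≤ a → 0 ≤ b → x - y = a - b →
      L x - L y = L a - L b := by
    intro x y a b hx hy ha hb h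
    have h1 : x + b = a + y := by rw [sub_eq_sub_iff_add_eq_add] at h; exact h
    have h2 := congrArg L h1
    rw [hadd x b hx hb, hadd a y ha hy] at h2
    linarith
  let P : E →+ ℝ :=
    { toFun := fun x => L x⁺ - L x⁻
      map_zero' := by simp
      map_add' := fun x y => by
        rw [hsub (x + y)⁺ (x + y)⁻ (x⁺ + y⁺) (x⁻ + y⁻) (posPart_nonneg _) (negPart_nonneg _)
          (add_nonneg (posPart_nonneg _) (posPart_nonneg _))
          (add_nonneg (negPart_nonneg _) (negPart_nonneg _)),
          hadd _ _ (posPart_nonneg _) (posPart_nonneg _),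
          hadd _ _ (negPart_nonneg _) (negPart_nonneg _)]
        · ring
        · rw [posPart_sub_negPart, add_sub_add_comm, posPart_sub_negPart, posPart_sub_negPart] }
  have hle : ∀ x z : E, 0 ≤ z → z ≤ |x| → C * ‖z‖ ≤ C * ‖x‖ := fun x z hz hzx => by
    rcases le_or_gt 0 C with h | h
    · exact mul_le_mul_of_nonneg_left (HasSolidNorm.solid (by rwa [abs_of_nonneg hz])) h
    -- A negative `C` is possible only if every norm vanishes.
    · have h1 : ∀ y : E, ‖y‖ = 0 := fun y =>
        le_antisymm (nonpos_of_mul_nonneg_right (hC y) h) (norm_nonneg y)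
      rw [h1, h1]
  refine ⟨P.toRealLinearMap (AddMonoidHomClass.continuous_of_bound P (C + C) fun x => ?_),
    fun x hx => ?_⟩
  · have h1 := (hL _ (posPart_nonneg x)).trans (hle x _ (posPart_nonneg x)
      (sup_le (le_abs_self x) (abs_nonneg x)))
    have h2 := (hL _ (negPart_nonneg x)).trans (hle x _ (negPart_nonneg x)
      (sup_le (neg_le_abs x) (abs_nonneg x)))
    rw [add_mul]
    exact (abs_sub _ _).trans (add_le_add h1 h2)
  · change L x⁺ - L x⁻ = L x
    rw [posPart_of_nonneg hx, negPart_of_nonneg hx, h0, sub_zero]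

theorem add_inf_le_inf_add_inf {x y w : E} (hx : 0 ≤ x) (hy : 0 ≤ y) (hw : 0 ≤ w) :
    (x + y) ⊓ w ≤ x ⊓ w + y ⊓ w := by
  rw [add_inf, inf_add, inf_add]
  refine le_inf (le_inf inf_le_left ?_) (le_inf ?_ ?_)
  · exact inf_le_right.trans (le_add_of_nonneg_right hy)
  · exact inf_le_right.trans (le_add_of_nonneg_left hx)
  · exact inf_le_right.trans (le_add_of_nonneg_left hw)

/-- `ψ` is the part of `φ` carried by the band of `u`. The limit exists by monotonicity; it is
additive because `x ⊓ k • u + y ⊓ k • u ≤ (x + y) ⊓ 2k • u`. -/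
theorem exists_tendsto_apply_inf_nsmul {φ : StrongDual ℝ E} (hφ : 0 ≤ φ) {u : E} (hu : 0 ≤ u) :
    ∃ ψ : StrongDual ℝ E, ∀ x, 0 ≤ x →
      Tendsto (fun k : ℕ => φ (x ⊓ k • u)) atTop (𝓝 (ψ x)) := by
  have hmono : ∀ x : E, Monotone fun k : ℕ => φ (x ⊓ k • u) := fun x j k hjk =>
    apply_mono hφ (inf_le_inf_left _ (nsmul_le_nsmul_left hu hjk))
  have hbdd : ∀ x : E, BddAbove (Set.range fun k : ℕ => φ (x ⊓ k • u)) := fun x =>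
    ⟨φ x, by rintro _ ⟨k, rfl⟩; exact apply_mono hφ inf_le_left⟩
  have hlim : ∀ x : E, Tendsto (fun k : ℕ => φ (x ⊓ k • u)) atTop (𝓝 (⨆ k : ℕ, φ (x ⊓ k • u))) :=
    fun x => tendsto_atTop_ciSup (hmono x) (hbdd x)
  have hk : ∀ k : ℕ, 0 ≤ k • u := fun k => nsmul_nonneg hu k
  suffices h : ∃ ψ : StrongDual ℝ E, ∀ x, 0 ≤ x → ψ x = ⨆ k : ℕ, φ (x ⊓ k • u) by
    obtain ⟨ψ, hψ⟩ := h
    exact ⟨ψ, fun x hx => by rw [hψ x hx]; exact hlim x⟩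
  refine exists_strongDual_of_additive_on_cone (C := ‖φ‖) ?_ ?_
  · intro x y hx hy
    apply le_antisymm
    · refine le_of_tendsto_of_tendsto' (hlim (x + y)) ((hlim x).add (hlim y)) fun k => ?_
      rw [← map_add]
      exact apply_mono hφ (add_inf_le_inf_add_inf hx hy (hk k))
    · refine le_of_tendsto' ((hlim x).add (hlim y)) fun k => ?_
      rw [← map_add]
      refine le_trans (apply_mono hφ (le_inf (add_le_add inf_le_left inf_le_left) ?_))
        (le_ciSup (hbdd (x + y)) (k + k))
      rw [add_nsmul]
      exact add_le_add inf_le_right inf_le_right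
  · intro x hx
    have h0 : 0 ≤ ⨆ k : ℕ, φ (x ⊓ k • u) :=
      ge_of_tendsto' (hlim x) fun k => apply_nonneg hφ (le_inf hx (hk k))
    rw [abs_of_nonneg h0]
    refine le_of_tendsto' (hlim x) fun k => (apply_mono hφ inf_le_left).trans ?_
    exact (Real.le_norm_self _).trans (φ.le_opNorm x)

/-- Write `f = |f| - (|f| - f)` and restrict both positive terms. The majorant `h` of `|g|` is kept
because disjointness is proved for positive functionals. -/
theorem exists_tendsto_apply_and_abs_apply_inf_nsmul (f : StrongDual ℝ E) {u : E} (hu : 0 ≤ u) :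
    ∃ g h : StrongDual ℝ E, |g| ≤ h ∧
      (∀ x, 0 ≤ x → Tendsto (fun k : ℕ => f (x ⊓ k • u)) atTop (𝓝 (g x))) ∧
      ∀ x, 0 ≤ x → Tendsto (fun k : ℕ => |f| (x ⊓ k • u)) atTop (𝓝 (h x)) := by
  obtain ⟨ψ, hψ⟩ := exists_tendsto_apply_inf_nsmul (abs_nonneg f) hu
  obtain ⟨χ, hχ⟩ := exists_tendsto_apply_inf_nsmul (sub_nonneg.2 (le_abs_self f)) hu
  have hlim : ∀ x, 0 ≤ x → Tendsto (fun k : ℕ => f (x ⊓ k • u)) atTop (𝓝 ((ψ - χ) x)) := by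
    intro x hx
    have := (hψ x hx).sub (hχ x hx)
    simpa using this
  refine ⟨ψ - χ, ψ, sup_le ?_ ?_, hlim, hψ⟩
  · intro x hx
    refine le_of_tendsto_of_tendsto' (hlim x hx) (hψ x hx) fun k => ?_
    exact le_abs_self f _ (le_inf hx (nsmul_nonneg hu k))
  · intro x hx
    refine le_of_tendsto_of_tendsto' (hlim x hx).neg (hψ x hx) fun k => ?_
    exact neg_le_abs f _ (le_inf hx (nsmul_nonneg hu k))

theorem nsmul_inf_nsmul_eq_zero {u v : E} (hu : 0 ≤ u) (hv : 0 ≤ v) (h : u ⊓ v = 0) (j k : ℕ) :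
    j • u ⊓ k • v = 0 := by
  have h1 : ∀ (a b : E), 0 ≤ a → 0 ≤ b → a ⊓ b = 0 → ∀ k : ℕ, a ⊓ k • b = 0 := by
    intro a b ha hb hab k
    have := inf_sum_eq_zero_of_nonneg (Finset.range k) (v := fun _ => b) ha (fun _ _ => hb)
      (fun _ _ => hab)
    simpa using this
  have h2 := h1 u v hu hv h k
  rw [inf_comm] at h2 ⊢
  exact h1 _ _ (nsmul_nonneg hv k) hu h2 j

/-- Cut `x` at `y = x ⊓ k • u₂`: `ψ₁` vanishes at `y`, and `ψ₂ (x - y)` tends to zero as `k` grows.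
-/
theorem inf_eq_zero_of_tendsto_apply_inf_nsmul {φ₁ φ₂ ψ₁ ψ₂ : StrongDual ℝ E} {u₁ u₂ : E}
    (hψ₁ : 0 ≤ ψ₁) (hψ₂ : 0 ≤ ψ₂) (hu₁ : 0 ≤ u₁) (hu₂ : 0 ≤ u₂) (hu : u₁ ⊓ u₂ = 0)
    (h₁ : ∀ x, 0 ≤ x → Tendsto (fun k : ℕ => φ₁ (x ⊓ k • u₁)) atTop (𝓝 (ψ₁ x)))
    (h₂ : ∀ x, 0 ≤ x → Tendsto (fun k : ℕ => φ₂ (x ⊓ k • u₂)) atTop (𝓝 (ψ₂ x))) :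
    ψ₁ ⊓ ψ₂ = 0 := by
  refine le_antisymm ?_ (le_inf hψ₁ hψ₂)
  intro x hx
  have key : ∀ k : ℕ, (ψ₁ ⊓ ψ₂) x ≤ ψ₂ x - φ₂ (x ⊓ k • u₂) := by
    intro k
    set y := x ⊓ k • u₂ with hy
    have hy0 : 0 ≤ y := le_inf hx (nsmul_nonneg hu₂ k)
    have e1 : ψ₁ y = 0 := by
      refine tendsto_nhds_unique (h₁ y hy0) ?_
      have : ∀ j : ℕ, y ⊓ j • u₁ = 0 := fun j =>
        inf_eq_zero_of_le hy0 (nsmul_nonneg hu₁ j) inf_le_right le_rfl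
          (by rw [inf_comm]; exact nsmul_inf_nsmul_eq_zero hu₁ hu₂ hu j k)
      simp [this]
    have e2 : ψ₂ y = φ₂ y := by
      refine tendsto_nhds_unique (h₂ y hy0) (tendsto_const_nhds.congr' ?_)
      filter_upwards [eventually_ge_atTop k] with j hj
      rw [inf_eq_left.2]
      exact inf_le_right.trans (nsmul_le_nsmul_left hu₂ hj)
    have i1 : (ψ₁ ⊓ ψ₂) y ≤ ψ₁ y := (inf_le_left : ψ₁ ⊓ ψ₂ ≤ ψ₁) y hy0
    have i2 : (ψ₁ ⊓ ψ₂) (x - y) ≤ ψ₂ (x - y) :=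
      (inf_le_right : ψ₁ ⊓ ψ₂ ≤ ψ₂) _ (sub_nonneg.2 inf_le_left)
    rw [map_sub, map_sub] at i2
    linarith
  have hlim := (tendsto_const_nhds (x := ψ₂ x)).sub (h₂ x hx)
  rw [sub_self] at hlim
  exact ge_of_tendsto' hlim key

end BanachLatticeDual

/-! ### From the `p`-weak DP* property to the disjoint one -/

section DisjointDPStar

open BanachLatticeDual

/-- A sequence in the set either repeats a value infinitely often, or its indices tend to infinity
and a subsequence of it is a subsequence of `x`, with limit `0`. -/
theorem IsWeaklyPSummable.isWeaklyPCompact_insert_zero_range {E : Type*} [NormedAddCommGroup E]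
    [NormedSpace ℝ E] {p : ℝ} (hp : 0 < p) {x : ℕ → E} (hx : IsWeaklyPSummable p x) :
    IsWeaklyPCompact p (insert 0 (Set.range x)) := by
  intro y hy
  by_cases h : ∃ a ∈ insert 0 (Set.range x), ∃ᶠ n in atTop, y n = a
  · obtain ⟨a, ha, hfr⟩ := h
    obtain ⟨φ, hφ, hφ'⟩ := extraction_of_frequently_atTop hfr
    refine ⟨a, ha, φ, hφ, fun f => ?_⟩
    simp [hφ', Real.zero_rpow hp.ne', summable_zero]
  · push Not at h
    have hm : ∀ n, ∃ m, y n ≠ 0 → x m = y n := fun n => by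
      rcases hy n with h0 | ⟨m, hm⟩
      · exact ⟨0, fun h => (h h0).elim⟩
      · exact ⟨m, fun _ => hm⟩
    choose m hm using hm
    have h0 : ∀ᶠ n in atTop, y n ≠ 0 := h 0 (Set.mem_insert _ _)
    have hmt : Tendsto m atTop atTop := by
      refine tendsto_atTop.2 fun b => ?_
      filter_upwards [h0, (Finset.eventually_all (Finset.range b)).2 fun j _ =>
        h (x j) (Set.mem_insert_of_mem _ ⟨j, rfl⟩)] with n hn0 hn
      by_contra hlt
      exact hn (m n) (Finset.mem_range.2 (not_le.1 hlt)) (hm n hn0).symm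
    obtain ⟨ψ, hψ, hψm⟩ := strictMono_subseq_of_tendsto_atTop hmt
    refine ⟨0, Set.mem_insert _ _, ψ, hψ, fun f => ?_⟩
    refine (hx.comp_injective hψm.injective f).congr_cofinite ?_
    rw [Nat.cofinite_eq_atTop]
    filter_upwards [hψ.tendsto_atTop.eventually h0] with k hk
    simp [hm _ hk]

variable {E : Type*} [NormedAddCommGroup E] [Lattice E] [HasSolidNorm E] [IsOrderedAddMonoid E]
  [NormedSpace ℝ E] [CompleteSpace E]

/-- The functionals `g n` are the restrictions of `f n` to the bands generated by the disjoint
elements `x n`. -/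
theorem exists_disjoint_isWeakStarNull_apply_eq (hE : IsSigmaDedekindComplete E)
    {f : ℕ → StrongDual ℝ E} (hf : IsWeakStarNull f) {x : ℕ → E} (hx : IsDisjointSeq x) :
    ∃ g : ℕ → StrongDual ℝ E, IsDisjointSeq g ∧ IsWeakStarNull g ∧ ∀ n, g n (x n) = f n (x n) := by
  choose g h hgh hg hh using fun n =>
    exists_tendsto_apply_and_abs_apply_inf_nsmul (f n) (abs_nonneg (x n))
  have hpos : ∀ n, 0 ≤ h n := fun n => (abs_nonneg (g n)).trans (hgh n)
  refine ⟨g, fun m n hmn => ?_, ?_, fun n => ?_⟩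
  · exact inf_eq_zero_of_le (abs_nonneg _) (abs_nonneg _) (hgh m) (hgh n)
      (inf_eq_zero_of_tendsto_apply_inf_nsmul (hpos m) (hpos n) (abs_nonneg _) (abs_nonneg _)
        (hx m n hmn) (hh m) (hh n))
  · have key : ∀ y, 0 ≤ y → Tendsto (fun n => g n y) atTop (𝓝 0) := by
      intro y hy
      -- Truncating at a suitable finite `k n` replaces `g n y` by `f n` at a vector of `[0, y]`;
      -- these vectors are disjoint, so `f n` tends to zero along them.
      have hk : ∀ n : ℕ, ∃ k : ℕ, |f n (y ⊓ k • |x n|) - g n y| < 1 / ((n : ℝ) + 1) := fun n => by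
        have := Metric.tendsto_nhds.1 (hg n y hy) (1 / ((n : ℝ) + 1)) (by positivity)
        simpa only [Real.dist_eq] using this.exists
      choose k hk using hk
      have h0 : ∀ n, 0 ≤ y ⊓ k n • |x n| := fun n => le_inf hy (nsmul_nonneg (abs_nonneg _) _)
      have h1 : Tendsto (fun n => f n (y ⊓ k n • |x n|)) atTop (𝓝 0) := by
        refine tendsto_apply_of_disjoint_of_nonneg hE hf (x := y) (fun m n hmn => ?_) h0
          (fun n => inf_le_left)
        rw [abs_of_nonneg (h0 m), abs_of_nonneg (h0 n)]
        exact inf_eq_zero_of_le (h0 m) (h0 n) inf_le_right inf_le_right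
          (nsmul_inf_nsmul_eq_zero (abs_nonneg _) (abs_nonneg _) (hx m n hmn) _ _)
      have h2 : Tendsto (fun n => f n (y ⊓ k n • |x n|) - g n y) atTop (𝓝 0) :=
        squeeze_zero_norm (fun n => (hk n).le) tendsto_one_div_add_atTop_nhds_zero_nat
      simpa using h1.sub h2
    refine isWeakStarNull_iff.2 fun y => ?_
    have := (key _ (posPart_nonneg y)).sub (key _ (negPart_nonneg y))
    simpa only [← map_sub, posPart_sub_negPart, sub_zero] using this
  · have key : ∀ y, 0 ≤ y → y ≤ |x n| → g n y = f n y := fun y hy hyx => by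
      refine tendsto_nhds_unique (hg n y hy) (tendsto_const_nhds.congr' ?_)
      filter_upwards [eventually_ge_atTop 1] with k hk
      rw [inf_eq_left.2]
      exact hyx.trans (by simpa using nsmul_le_nsmul_left (abs_nonneg (x n)) hk)
    rw [← posPart_sub_negPart (x n), map_sub, map_sub,
      key _ (posPart_nonneg _) (sup_le (le_abs_self _) (abs_nonneg _)),
      key _ (negPart_nonneg _) (sup_le (neg_le_abs _) (abs_nonneg _))]

theorem HasPWeakDPStar.hasDisjointDPStar (hE : IsSigmaDedekindComplete E) {p : ℝ} (hp : 0 < p)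
    (h : HasPWeakDPStar E p) : HasDisjointDPStar E p := by
  intro x hx hxp
  refine isLimitedSet_range fun f hf φ hφ => ?_
  obtain ⟨g, hgd, hg, hgf⟩ :=
    exists_disjoint_isWeakStarNull_apply_eq hE hf (hx.comp_injective hφ.injective)
  have h1 := (h _ (hxp.isWeaklyPCompact_insert_zero_range hp)).2 g hgd hg
  rw [Metric.tendstoUniformlyOn_iff] at h1
  refine Metric.tendsto_nhds.2 fun ε hε => ?_
  filter_upwards [h1 ε hε] with n hn
  have := hn (x (φ n)) (Set.mem_insert_of_mem _ ⟨_, rfl⟩)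
  rwa [dist_comm, show g n (x (φ n)) = f n (x (φ n)) from hgf n] at this

end DisjointDPStar

/-! ### Disjoint weak* null sequences -/

namespace BanachLatticeDual

variable {E : Type*} [NormedAddCommGroup E] [Lattice E] [HasSolidNorm E] [IsOrderedAddMonoid E]
  [NormedSpace ℝ E]

/-- Finitely many disjoint functionals nearly attain their values at `x` on separate pieces of `x`:
split off `h j` from the sum of the others, and recurse. -/
theorem exists_sum_le_forall_sub_lt_apply {h : ℕ → StrongDual ℝ E} (h0 : ∀ n, 0 ≤ h n)
    (hh : ∀ m n, m ≠ n → h m ⊓ h n = 0) (s : Finset ℕ) {x : E} (hx : 0 ≤ x) {δ : ℝ}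
    (hδ : 0 < δ) :
    ∃ v : ℕ → E, (∀ i, 0 ≤ v i) ∧ ∑ i ∈ s, v i ≤ x ∧ ∀ i ∈ s, h i x - δ < h i (v i) := by
  induction s using Finset.induction_on generalizing x δ with
  | empty => exact ⟨fun _ => 0, fun _ => le_rfl, by simpa using hx, by simp⟩
  | insert j s hj ih =>
    have hjs : (∑ i ∈ s, h i) ⊓ h j = 0 := by
      rw [inf_comm]
      refine inf_sum_eq_zero_of_nonneg s (h0 j) (fun i _ => h0 i) fun i hi => hh j i ?_
      rintro rfl
      exact hj hi
    obtain ⟨y, hy0, hyx, hy⟩ := exists_add_lt_of_inf_eq_zero hjs hx (half_pos hδ)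
    obtain ⟨v, hv0, hvy, hv⟩ := ih hy0 (half_pos hδ)
    have hxy : 0 ≤ x - y := sub_nonneg.2 hyx
    have hne : ∀ i ∈ s, i ≠ j := fun i hi => by rintro rfl; exact hj hi
    refine ⟨Function.update v j (x - y), fun i => ?_, ?_, fun i hi => ?_⟩
    · rcases eq_or_ne i j with rfl | hij
      · simpa using hyx
      · simpa [hij] using hv0 i
    · rw [Finset.sum_insert hj, Function.update_self,
        Finset.sum_congr rfl fun i hi => Function.update_of_ne (hne i hi) _ _]
      calc x - y + ∑ i ∈ s, v i ≤ x - y + y := by gcongr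
        _ = x := sub_add_cancel x y
    · have hsum : 0 ≤ (∑ i ∈ s, h i) (x - y) :=
        apply_nonneg (Finset.sum_nonneg fun i _ => h0 i) hxy
      rcases Finset.mem_insert.1 hi with rfl | hi
      · rw [Function.update_self, map_sub]
        linarith
      · rw [Function.update_of_ne (hne i hi)]
        have h1 : h i (x - y) ≤ (∑ i ∈ s, h i) (x - y) :=
          Finset.single_le_sum (fun i _ => h0 i) hi (x - y) hxy
        have h2 := hv i hi
        have h3 := apply_nonneg (h0 j) hy0
        rw [map_sub] at h1
        linarith

/-- Pigeonhole: more than `C / η` pieces `v i` sum to at most `x`, so every `h m` is at most `η` on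
one of them, and one piece serves infinitely many `m`. -/
theorem exists_mem_exists_infinite_subset {h : ℕ → StrongDual ℝ E} (h0 : ∀ n, 0 ≤ h n)
    (hh : ∀ m n, m ≠ n → h m ⊓ h n = 0) {x : E} (hx : 0 ≤ x) {C ε η : ℝ} (hC : ∀ n, h n x ≤ C)
    (hε : 0 < ε) (hhε : ∀ n, ε ≤ h n x) (hη : 0 < η) {S : Set ℕ} (hS : S.Infinite) :
    ∃ n ∈ S, ∃ v : E, 0 ≤ v ∧ v ≤ x ∧ ε / 2 ≤ h n v ∧
      ∃ T : Set ℕ, T.Infinite ∧ T ⊆ S ∧ ∀ m ∈ T, n < m ∧ h m v ≤ η := by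
  obtain ⟨N, hN⟩ := exists_nat_gt (C / η)
  rw [div_lt_iff₀ hη] at hN
  obtain ⟨s, hsS, hs⟩ := hS.exists_subset_card_eq (N + 1)
  obtain ⟨v, hv0, hvx, hv⟩ := exists_sum_le_forall_sub_lt_apply h0 hh s hx (half_pos hε)
  have hne : s.Nonempty := Finset.card_pos.1 (by omega)
  have hex : ∀ m, ∃ i ∈ s, h m (v i) ≤ η := fun m => by
    refine Finset.exists_le_of_sum_le hne ?_
    rw [← map_sum, Finset.sum_const, hs, nsmul_eq_mul]
    have := (apply_mono (h0 m) hvx).trans (hC m)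
    push_cast
    linarith
  obtain ⟨i, hi, hinf⟩ : ∃ i ∈ s, {m ∈ S | h m (v i) ≤ η}.Infinite := by
    by_contra hcon
    push Not at hcon
    refine hS ((Set.Finite.biUnion s.finite_toSet hcon).subset fun m hm => ?_)
    obtain ⟨i, hi, hmi⟩ := hex m
    exact Set.mem_biUnion hi ⟨hm, hmi⟩
  refine ⟨i, hsS hi, v i, hv0 i, (Finset.single_le_sum (fun j _ => hv0 j) hi).trans hvx, ?_,
    {m ∈ S | h m (v i) ≤ η} \ Set.Iic i, hinf.sdiff (Set.finite_Iic i), fun m hm => hm.1.1,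
    fun m hm => ⟨not_le.1 hm.2, hm.1.2⟩⟩
  linarith [hv i hi, hhε i]

theorem exists_strictMono_forall_apply_le {h : ℕ → StrongDual ℝ E} (h0 : ∀ n, 0 ≤ h n)
    (hh : ∀ m n, m ≠ n → h m ⊓ h n = 0) {x : E} (hx : 0 ≤ x) {C ε : ℝ} (hC : ∀ n, h n x ≤ C)
    (hε : 0 < ε) (hhε : ∀ n, ε ≤ h n x) {η : ℕ → ℝ} (hη : ∀ k, 0 < η k) :
    ∃ φ : ℕ → ℕ, StrictMono φ ∧ ∃ v : ℕ → E, (∀ k, 0 ≤ v k) ∧ (∀ k, v k ≤ x) ∧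
      (∀ k, ε / 2 ≤ h (φ k) (v k)) ∧ ∀ i k, i < k → h (φ k) (v i) ≤ η i := by
  choose n hn v hv0 hvx hvε T hT hTS hTη using fun (S : {S : Set ℕ // S.Infinite}) (k : ℕ) =>
    exists_mem_exists_infinite_subset h0 hh hx hC hε hhε (hη k) S.2
  -- Nested infinite index sets; index `k` is drawn from the `k`th, so every later index stays small
  -- on `v i`.
  let S : ℕ → {S : Set ℕ // S.Infinite} := fun k =>
    Nat.rec ⟨Set.univ, Set.infinite_univ⟩ (fun k S => ⟨T S k, hT S k⟩) k
  have hanti : Antitone fun k => (S k).1 := antitone_nat_of_succ_le fun k => hTS (S k) k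
  have hmem : ∀ i k, i < k → n (S k) k ∈ T (S i) i := fun i k hik =>
    hanti (Nat.succ_le_of_lt hik) (hn (S k) k)
  exact ⟨fun k => n (S k) k,
    strictMono_nat_of_lt_succ fun k => (hTη (S k) k _ (hmem k (k + 1) k.lt_succ_self)).1,
    fun k => v (S k) k, fun k => hv0 _ _, fun k => hvx _ _, fun k => hvε _ _,
    fun i k hik => (hTη (S i) i _ (hmem i k hik)).2⟩

variable [CompleteSpace E] [IsOrderedModule ℝ E]

/-- Otherwise pieces of `x` on which later functionals are small could be disjointified inside `[0,
x]` while keeping `|f n|` bounded below, against the convergence along disjoint order bounded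
sequences. -/
theorem not_forall_le_abs_apply (hE : IsSigmaDedekindComplete E)
    {f : ℕ → StrongDual ℝ E} (hd : IsDisjointSeq f) (hf : IsWeakStarNull f) {x : E} (hx : 0 ≤ x)
    {ε : ℝ} (hε : 0 < ε) : ¬ ∀ n, ε ≤ |f n| x := by
  intro hle
  obtain ⟨C', hC', hfC⟩ := hf.exists_norm_le
  obtain ⟨C, hC, hxC⟩ : ∃ C, 0 < C ∧ ∀ n, |f n| x ≤ C := by
    refine ⟨C' * ‖x‖ + 1, by positivity, fun n => ?_⟩
    have := mul_le_mul_of_nonneg_right (hfC n) (norm_nonneg x)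
    linarith [abs_apply_le_norm_mul (f n) hx]
  -- With this `c` the term `(1 / c) • x` costs at most `ε / 8`; the choice of `η` below makes the
  -- earlier pieces cost at most `ε / 8` as well, so `ε / 4` of `ε / 2` survives.
  set c : ℝ := 8 * C / ε with hc
  have hc0 : 0 < c := by positivity
  obtain ⟨φ, hφ, v, hv0, hvx, hvε, hvη⟩ := exists_strictMono_forall_apply_le
    (fun n => abs_nonneg (f n)) hd hx hxC hε hle
    (η := fun i => ε / (16 * c) * (1 / 2) ^ i) (fun i => by positivity)
  set w : ℕ → E := fun k => (v k - c • ∑ i ∈ Finset.range k, v i - (1 / c) • x)⁺ with hw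
  have hw0 : ∀ k, 0 ≤ w k := fun k => posPart_nonneg _
  have hwd : IsDisjointSeq w := isDisjointSeq_posPart_sub_sum (a := fun _ => c)
    (b := fun _ => 1 / c) (r := fun _ => 1) hx hv0 (fun _ => hc0.le) (fun _ => by positivity)
    (fun _ => one_pos) (fun k => by simpa using hvx k) (fun _ _ _ => by simp)
  have hwx : ∀ k, w k ≤ x := fun k => by
    refine sup_le (((sub_le_self _ ?_).trans (sub_le_self _ ?_)).trans (hvx k)) hx
    · exact smul_nonneg (by positivity) hx
    · exact smul_nonneg hc0.le (Finset.sum_nonneg fun i _ => hv0 i)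
  have hwε : ∀ k, ε / 4 ≤ |f (φ k)| (w k) := fun k => by
    have h1 : |f (φ k)| (v k - c • ∑ i ∈ Finset.range k, v i - (1 / c) • x) ≤ |f (φ k)| (w k) :=
      apply_mono (abs_nonneg _) (le_posPart _)
    rw [map_sub, map_sub, map_smul, map_smul, map_sum, smul_eq_mul, smul_eq_mul] at h1
    have h2 : ∑ i ∈ Finset.range k, |f (φ k)| (v i) ≤ ε / (16 * c) * 2 := by
      calc ∑ i ∈ Finset.range k, |f (φ k)| (v i)
          ≤ ∑ i ∈ Finset.range k, ε / (16 * c) * (1 / 2 : ℝ) ^ i :=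
            Finset.sum_le_sum fun i hi => hvη i k (Finset.mem_range.1 hi)
        _ ≤ ε / (16 * c) * 2 := by
            rw [← Finset.mul_sum]
            exact mul_le_mul_of_nonneg_left (sum_geometric_two_le k) (by positivity)
    have h3 : c * ∑ i ∈ Finset.range k, |f (φ k)| (v i) ≤ ε / 8 := by
      calc c * ∑ i ∈ Finset.range k, |f (φ k)| (v i) ≤ c * (ε / (16 * c) * 2) := by gcongr
        _ = ε / 8 := by field_simp; norm_num
    have h4 : 1 / c * |f (φ k)| x ≤ ε / 8 := by
      calc 1 / c * |f (φ k)| x ≤ 1 / c * C := by gcongr; exact hxC _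
        _ = ε / 8 := by rw [hc]; field_simp
    linarith [hvε k]
  choose z hzw hz using fun k => exists_abs_le_lt_apply (f (φ k)) (hw0 k)
    (by positivity : 0 < ε / 8)
  have hlim := tendsto_apply_of_disjoint_of_abs_le hE (hf.comp_strictMono hφ)
    (hwd.of_abs_le fun k => by rw [abs_of_nonneg (hw0 k)]; exact hzw k)
    (fun k => (hzw k).trans (hwx k))
  have := ge_of_tendsto' hlim fun k => (show ε / 8 ≤ f (φ k) (z k) by linarith [hz k, hwε k])
  linarith

theorem tendsto_abs_apply_of_disjoint (hE : IsSigmaDedekindComplete E)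
    {f : ℕ → StrongDual ℝ E} (hd : IsDisjointSeq f) (hf : IsWeakStarNull f) {x : E} (hx : 0 ≤ x) :
    Tendsto (fun n => |f n| x) atTop (𝓝 0) :=
  tendsto_zero_of_forall_subseq fun _ hε _ hφ h =>
    not_forall_le_abs_apply hE (hd.comp_injective hφ.injective) (hf.comp_strictMono hφ) hx hε
      fun n => (h n).trans (abs_of_nonneg (apply_nonneg (abs_nonneg _) hx)).le

end BanachLatticeDual

/-! ### Disjoint sequences dominated by weakly `p`-summable sequences -/

/-- Hölder bounds each functional on all combinations with coefficients in the `ℓ^q` unit ball;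
uniform boundedness then bounds their norms. -/
theorem IsWeaklyPSummable.exists_norm_sum_smul_le {E : Type*} [NormedAddCommGroup E]
    [NormedSpace ℝ E] {p q : ℝ} (hpq : p.HolderConjugate q) {x : ℕ → E}
    (hx : IsWeaklyPSummable p x) :
    ∃ C, ∀ (N : ℕ) (a : Fin N → ℝ), ∑ i, |a i| ^ q ≤ 1 → ‖∑ i, a i • x i‖ ≤ C := by
  suffices h : ∃ C, ∀ t : Σ N : ℕ, {a : Fin N → ℝ // ∑ i, |a i| ^ q ≤ 1},
      ‖∑ i, t.2.1 i • x i‖ ≤ C by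
    obtain ⟨C, hC⟩ := h
    exact ⟨C, fun N a ha => hC ⟨N, a, ha⟩⟩
  refine exists_norm_le_of_forall_dual_bounded fun f => ?_
  refine ⟨(∑' n, |f (x n)| ^ p) ^ (1 / p), ?_⟩
  rintro ⟨N, a, ha⟩
  have hp0 : 0 ≤ 1 / p := by have := hpq.pos; positivity
  have hq0 : 0 ≤ 1 / q := by have := hpq.symm.pos; positivity
  have h1 : (∑ i, |a i| ^ q) ^ (1 / q) ≤ 1 :=
    Real.rpow_le_one (Finset.sum_nonneg fun i _ => by positivity) ha hq0
  have h2 : ∑ i : Fin N, |f (x i)| ^ p ≤ ∑' n, |f (x n)| ^ p := by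
    rw [Fin.sum_univ_eq_sum_range (fun n => |f (x n)| ^ p)]
    exact (hx f).sum_le_tsum _ fun n _ => by positivity
  calc |f (∑ i, a i • x i)| = |∑ i, a i * f (x i)| := by simp [map_sum]
    _ ≤ ∑ i, |a i| * |f (x i)| := by
      simpa only [abs_mul] using Finset.abs_sum_le_sum_abs (fun i => a i * f (x i)) _
    _ ≤ (∑ i, |a i| ^ q) ^ (1 / q) * (∑ i : Fin N, |f (x i)| ^ p) ^ (1 / p) := by
      simpa only [abs_abs] using
        Real.inner_le_Lp_mul_Lq Finset.univ (fun i => |a i|) (fun i => |f (x i)|) hpq.symm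
    _ ≤ 1 * (∑' n, |f (x n)| ^ p) ^ (1 / p) := by gcongr
    _ = _ := one_mul _

section Domination

open BanachLatticeDual

variable {E : Type*} [NormedAddCommGroup E] [Lattice E] [HasSolidNorm E] [IsOrderedAddMonoid E]
  [NormedSpace ℝ E] [IsOrderedModule ℝ E]

theorem smul_abs_le_abs_smul {c : ℝ} (hc : 0 ≤ c) (x : E) : c • |x| ≤ |c • x| := by
  rcases hc.eq_or_lt with rfl | hc
  · simp
  · rw [← le_inv_smul_iff_of_pos hc]
    refine sup_le ?_ ?_
    · rw [le_inv_smul_iff_of_pos hc]; exact le_abs_self _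
    · rw [le_inv_smul_iff_of_pos hc, smul_neg]; exact neg_le_abs _

/-- Flipping the sign at `m` changes a signed sum by `±2 X m`, so `2 |X m|` is at most the sum of
the two moduli. Sum over all sign patterns. -/
theorem card_smul_abs_le_sum_abs_signed_sum {ι : Type*} [Fintype ι] [DecidableEq ι]
    (X : ι → E) (m : ι) :
    (Fintype.card (ι → ℤˣ) : ℝ) • |X m| ≤ ∑ σ : ι → ℤˣ, |∑ i, (((σ i : ℤ) : ℝ)) • X i| := by
  set S : (ι → ℤˣ) → E := fun σ => ∑ i, (((σ i : ℤ) : ℝ)) • X i with hS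
  set τ : ι → ℤˣ := Pi.mulSingle m (-1) with hτ
  have hflip : ∀ σ, S σ - S (σ * τ) = (2 * ((σ m : ℤ) : ℝ)) • X m := by
    intro σ
    rw [hS]
    simp only
    rw [← Finset.sum_sub_distrib, Finset.sum_eq_single m]
    · simp only [hτ, Pi.mul_apply, Pi.mulSingle_eq_same, ← sub_smul]
      congr 1
      push_cast
      ring
    · intro i _ hi
      simp [hτ, hi]
    · simp
  have habs : ∀ σ : ι → ℤˣ, (2 : ℝ) • |X m| ≤ |S σ| + |S (σ * τ)| := by
    intro σ
    have h1 : (2 : ℝ) • |X m| ≤ |S σ - S (σ * τ)| := by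
      rw [hflip]
      refine (smul_abs_le_abs_smul zero_le_two _).trans (le_of_eq ?_)
      rcases Int.units_eq_one_or (σ m) with h | h <;> rw [h] <;> simp
    refine h1.trans ?_
    rw [sub_eq_add_neg, ← abs_neg (S (σ * τ))]
    exact abs_add_le _ _
  have hsum : ∑ σ, |S (σ * τ)| = ∑ σ, |S σ| :=
    Fintype.sum_equiv (Equiv.mulRight τ) _ _ fun σ => rfl
  have h2 : (Fintype.card (ι → ℤˣ)) • ((2 : ℝ) • |X m|) ≤ ∑ σ, |S σ| + ∑ σ, |S σ| := by
    calc (Fintype.card (ι → ℤˣ)) • ((2 : ℝ) • |X m|) = ∑ _σ : ι → ℤˣ, (2 : ℝ) • |X m| := by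
          rw [Finset.sum_const, Finset.card_univ]
      _ ≤ ∑ σ, (|S σ| + |S (σ * τ)|) := Finset.sum_le_sum fun σ _ => habs σ
      _ = _ := by rw [Finset.sum_add_distrib, hsum]
  rw [← two_smul ℝ, ← Nat.cast_smul_eq_nsmul ℝ, smul_comm] at h2
  exact le_of_smul_le_smul_left h2 two_pos

/-- Each `Y i` lies below the average modulus of the signed sums. For disjoint vectors the sum is
the supremum, so `∑ Y i` lies below that average too. -/
theorem sum_apply_le_of_forall_norm_signed_sum_le {ι : Type*} [Fintype ι] [DecidableEq ι]
    {φ : StrongDual ℝ E} (hφ : 0 ≤ φ) {X Y : ι → E} {C : ℝ} (hY : ∀ i, 0 ≤ Y i)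
    (hYd : ∀ i j, i ≠ j → Y i ⊓ Y j = 0) (hYX : ∀ i, Y i ≤ |X i|)
    (hC : ∀ σ : ι → ℤˣ, ‖∑ i, (((σ i : ℤ) : ℝ)) • X i‖ ≤ C) :
    ∑ i, φ (Y i) ≤ ‖φ‖ * C := by
  set K : ℝ := (Fintype.card (ι → ℤˣ) : ℝ) with hK
  have hK0 : 0 < K := by rw [hK]; exact_mod_cast Fintype.card_pos
  set V : E := ∑ σ : ι → ℤˣ, |∑ i, (((σ i : ℤ) : ℝ)) • X i| with hV
  have hYV : ∀ i, Y i ≤ K⁻¹ • V := fun i => by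
    rw [le_inv_smul_iff_of_pos hK0]
    exact (smul_le_smul_of_nonneg_left (hYX i) hK0.le).trans
      (card_smul_abs_le_sum_abs_signed_sum X i)
  have hsum : ∑ i, Y i ≤ K⁻¹ • V :=
    sum_le_of_pairwise_inf_eq_zero _ (smul_nonneg (by positivity)
      (Finset.sum_nonneg fun σ _ => abs_nonneg _)) hY hYd hYV
  have hφV : φ V ≤ K * (‖φ‖ * C) := by
    rw [hV, map_sum, hK, ← nsmul_eq_mul, ← Finset.card_univ, ← Finset.sum_const]
    refine Finset.sum_le_sum fun σ _ => (Real.le_norm_self _).trans ?_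
    exact φ.le_opNorm_of_le (by rw [norm_abs_eq_norm]; exact hC σ)
  calc ∑ i, φ (Y i) = φ (∑ i, Y i) := (map_sum _ _ _).symm
    _ ≤ φ (K⁻¹ • V) := apply_mono hφ hsum
    _ = K⁻¹ * φ V := by simp
    _ ≤ K⁻¹ * (K * (‖φ‖ * C)) := by gcongr
    _ = ‖φ‖ * C := inv_mul_cancel_left₀ hK0.ne' _

theorem IsWeaklyPSummable.of_disjoint_of_abs_le {p : ℝ} (hp : 1 < p) {x y : ℕ → E}
    (hx : IsWeaklyPSummable p x) (hy : IsDisjointSeq y) (hyx : ∀ n, |y n| ≤ |x n|) :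
    IsWeaklyPSummable p y := by
  intro f
  have hpq := Real.HolderConjugate.conjExponent hp
  set q := p.conjExponent with hq
  obtain ⟨C, hC⟩ := hx.exists_norm_sum_smul_le hpq
  have hp0 : 0 < p := hpq.pos
  have hq0 : 0 < q := hpq.symm.pos
  set b : ℕ → ℝ := fun n => |f| |y n| with hb
  have hb0 : ∀ n, 0 ≤ b n := fun n => apply_nonneg (abs_nonneg f) (abs_nonneg _)
  have hsum : Summable fun n => b n ^ p := by
    refine summable_of_sum_range_le (c := (‖|f|‖ * C) ^ p) (fun n => by have := hb0 n; positivity)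
      fun N => ?_
    rw [← Fin.sum_univ_eq_sum_range (fun n => b n ^ p)]
    set T := ∑ i : Fin N, b i ^ p with hT
    have hT0 : 0 ≤ T := Finset.sum_nonneg fun i _ => by have := hb0 i; positivity
    rcases hT0.eq_or_lt with h0 | hTpos
    · rw [← h0]
      refine Real.rpow_nonneg ?_ _
      have : 0 ≤ C := (norm_nonneg _).trans (hC 0 (fun _ => 0) (by simp))
      positivity
    -- The extremal coefficients in Hölder's inequality: unit `ℓ^q` norm, and pairing with `b` gives
    -- `T ^ (1 / p)`.
    set a : Fin N → ℝ := fun i => b i ^ (p - 1) / T ^ (1 / q) with ha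
    have ha0 : ∀ i, 0 ≤ a i := fun i => by have := hb0 i; positivity
    have hTq : (T ^ (1 / q)) ^ q = T := by
      rw [← Real.rpow_mul hT0, one_div_mul_cancel hq0.ne', Real.rpow_one]
    have haq : ∑ i, a i ^ q = 1 := by
      have : ∀ i, a i ^ q = b i ^ p / T := fun i => by
        rw [ha, Real.div_rpow (Real.rpow_nonneg (hb0 i) _) (by positivity), hTq,
          ← Real.rpow_mul (hb0 i), hpq.sub_one_mul_conj]
      simp only [this]
      rw [← Finset.sum_div, ← hT, div_self hTpos.ne']
    have hab : ∑ i, a i * b i = T ^ (1 / p) := by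
      have h1 : ∀ i : Fin N, a i * b i = b i ^ p / T ^ (1 / q) := fun i => by
        rw [ha, div_mul_eq_mul_div]
        congr 1
        rcases (hb0 i).eq_or_lt with h | h
        · rw [← h, mul_zero, Real.zero_rpow hp0.ne']
        · rw [Real.rpow_sub_one h.ne', div_mul_cancel₀ _ h.ne']
      simp only [h1]
      rw [← Finset.sum_div, ← hT, div_eq_iff (by positivity), ← Real.rpow_add hTpos]
      simp only [one_div, hpq.inv_add_inv_eq_one, Real.rpow_one]
    have key := sum_apply_le_of_forall_norm_signed_sum_le (abs_nonneg f)
      (X := fun i : Fin N => a i • x i) (Y := fun i : Fin N => a i • |y i|) (C := C)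
      (fun i => smul_nonneg (ha0 i) (abs_nonneg _)) ?_ ?_ ?_
    · have h2 : T ^ (1 / p) ≤ ‖|f|‖ * C := by
        rw [← hab]
        simpa [hb] using key
      calc T = (T ^ (1 / p)) ^ p := by
            rw [← Real.rpow_mul hT0, one_div_mul_cancel hp0.ne', Real.rpow_one]
        _ ≤ _ := Real.rpow_le_rpow (by positivity) h2 hp0.le
    · intro i j hij
      have h1 := hy i j (by simpa [Fin.ext_iff] using hij)
      have hm : 0 < max (a i) (a j) + 1 := by
        have := (ha0 i).trans (le_max_left (a i) (a j)); linarith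
      set c := max (a i) (a j) + 1
      have hle : ∀ l : Fin N, a l ≤ c → a l • |y l| ≤ c • |y l| := fun l hl =>
        smul_le_smul_of_nonneg_right hl (abs_nonneg _)
      have hi := hle i (by linarith [le_max_left (a i) (a j)])
      have hj := hle j (by linarith [le_max_right (a i) (a j)])
      refine le_antisymm ?_ (le_inf (smul_nonneg (ha0 i) (abs_nonneg _))
        (smul_nonneg (ha0 j) (abs_nonneg _)))
      have h3 : c⁻¹ • (a i • |y i| ⊓ a j • |y j|) ≤ |y i| ⊓ |y j| :=
        le_inf ((inv_smul_le_iff_of_pos hm).2 (inf_le_left.trans hi))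
          ((inv_smul_le_iff_of_pos hm).2 (inf_le_right.trans hj))
      rwa [h1, inv_smul_le_iff_of_pos hm, smul_zero] at h3
    · intro i
      exact (smul_le_smul_of_nonneg_left (hyx i) (ha0 i)).trans
        (smul_abs_le_abs_smul (ha0 i) _)
    · intro σ
      have := hC N (fun i => ((σ i : ℤ) : ℝ) * a i) (le_of_eq ?_)
      · simpa only [smul_smul] using this
      · rw [← haq]
        refine Finset.sum_congr rfl fun i _ => ?_
        have : |((σ i : ℤ) : ℝ)| = 1 := by
          rcases Int.units_eq_one_or (σ i) with h | h <;> rw [h] <;> simp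
        rw [abs_mul, this, one_mul, abs_of_nonneg (ha0 i)]
  refine hsum.of_nonneg_of_le (fun n => by positivity) fun n => ?_
  exact Real.rpow_le_rpow (abs_nonneg _) (abs_apply_le f (y n)) hp0.le

end Domination

/-! ### The main theorem -/

section Main

open BanachLatticeDual

theorem IsWeaklyPCompact.isBounded {E : Type*} [NormedAddCommGroup E] [NormedSpace ℝ E] {p : ℝ}
    (hp : 0 < p) {A : Set E} (hA : IsWeaklyPCompact p A) : Bornology.IsBounded A := by
  rw [isBounded_iff_forall_norm_le]
  by_contra hcon
  push Not at hcon
  choose x hxA hx using fun n : ℕ => hcon n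
  obtain ⟨a, -, φ, hφ, hs⟩ := hA x hxA
  obtain ⟨C, hC⟩ := hs.exists_norm_le hp
  obtain ⟨n, hn⟩ := exists_nat_gt (C + ‖a‖)
  have h1 := hx (φ n)
  have h2 : (n : ℝ) ≤ φ n := by exact_mod_cast hφ.le_apply
  have h3 := norm_le_norm_sub_add (x (φ n)) a
  linarith [hC n]

theorem exists_strictMono_forall_succ {P : ℕ → ℕ → Prop} (h : ∀ m, ∀ᶠ n in atTop, P m n) :
    ∃ φ : ℕ → ℕ, StrictMono φ ∧ ∀ k, P (φ k) (φ (k + 1)) := by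
  choose g hg hgP using fun m => ((eventually_gt_atTop m).and (h m)).exists
  have hs : ∀ k, g^[k + 1] 0 = g (g^[k] 0) := fun k => Function.iterate_succ_apply' g k 0
  exact ⟨fun k => g^[k] 0, strictMono_nat_of_lt_succ fun k => (hg _).trans_eq (hs k).symm,
    fun k => by simpa only [hs] using hgP (g^[k] 0)⟩

variable {E : Type*} [NormedAddCommGroup E] [Lattice E] [HasSolidNorm E] [IsOrderedAddMonoid E]
  [NormedSpace ℝ E] [CompleteSpace E] [IsOrderedModule ℝ E]

theorem HasDisjointDPStar.not_forall_le_abs_apply (hE : IsSigmaDedekindComplete E) {p : ℝ}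
    (hp : 1 < p) (h : HasDisjointDPStar E p) {f : ℕ → StrongDual ℝ E} (hd : IsDisjointSeq f)
    (hf : IsWeakStarNull f) {x : ℕ → E} (hx : IsWeaklyPSummable p x) {ε : ℝ} (hε : 0 < ε) :
    ¬ ∀ n, ε ≤ |f n (x n)| := by
  intro hle
  obtain ⟨B, hB⟩ := hx.exists_norm_le (by linarith)
  obtain ⟨C, hC, hfC⟩ := hf.exists_norm_le
  obtain ⟨φ, hφ, hφε⟩ := exists_strictMono_forall_succ
    -- The condition sees only the previous index `m = φ k`, not `k`. Since `k ≤ φ k`, the power `4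
    -- ^ (m + 1)` and the sum over all `j ≤ m` dominate what step `k + 1` needs.
    (P := fun m n => |f n| ((4 : ℝ) ^ (m + 1) • ∑ j ∈ Finset.range (m + 1), |x j|) < ε / 8)
    fun m => (tendsto_abs_apply_of_disjoint hE hd hf (smul_nonneg (by positivity)
      (Finset.sum_nonneg fun j _ => abs_nonneg (x j)))).eventually
        (gt_mem_nhds (by positivity))
  set v : ℕ → E := fun k => |x (φ k)| with hv
  have hv0 : ∀ k, 0 ≤ v k := fun k => abs_nonneg _
  have hsumm : Summable fun k => (1 / 2 : ℝ) ^ k • v k := by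
    refine Summable.of_norm_bounded (g := fun k => (1 / 2 : ℝ) ^ k * B)
      (summable_geometric_two.mul_right B) fun k => ?_
    rw [norm_smul, norm_abs_eq_norm, Real.norm_of_nonneg (by positivity)]
    exact mul_le_mul_of_nonneg_left (hB _) (by positivity)
  have hnn : ∀ k, 0 ≤ (1 / 2 : ℝ) ^ k • v k := fun k => smul_nonneg (by positivity) (hv0 k)
  -- A common majorant: `v k ≤ 2 ^ k • u`. Disjointness of `w` needs `2 ^ k * 2 ^ i ≤ 4 ^ k` for `i
  -- < k`, whence the factor `4 ^ k`.
  set u : E := ∑' k, (1 / 2 : ℝ) ^ k • v k with hu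
  have hu0 : 0 ≤ u := tsum_nonneg hnn
  have hvu : ∀ k, v k ≤ (2 : ℝ) ^ k • u := fun k => by
    have h1 : (1 / 2 : ℝ) ^ k • v k ≤ u := hsumm.le_tsum k fun j _ => hnn j
    calc v k = (2 : ℝ) ^ k • (1 / 2 : ℝ) ^ k • v k := by
          rw [smul_smul, ← mul_pow]; norm_num
      _ ≤ _ := by gcongr
  have hsmall : ∀ k, |f (φ k)| ((4 : ℝ) ^ k • ∑ i ∈ Finset.range k, v i) ≤ ε / 8 := by
    intro k
    cases k with
    | zero => simp; positivity
    | succ k =>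
      refine (apply_mono (abs_nonneg _) ?_).trans (hφε k).le
      have h1 : ∑ i ∈ Finset.range (k + 1), v i ≤ ∑ j ∈ Finset.range (φ k + 1), |x j| := by
        rw [← Finset.sum_image (s := Finset.range (k + 1)) (g := φ) (f := fun j => |x j|)
          hφ.injective.injOn]
        refine Finset.sum_le_sum_of_subset_of_nonneg ?_ fun j _ _ => abs_nonneg _
        intro j hj
        obtain ⟨i, hi, rfl⟩ := Finset.mem_image.1 hj
        have := hφ.monotone (Nat.lt_succ_iff.1 (Finset.mem_range.1 hi))
        exact Finset.mem_range.2 (Nat.lt_succ_iff.2 this)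
      have h2 : (4 : ℝ) ^ (k + 1) ≤ 4 ^ (φ k + 1) :=
        pow_le_pow_right₀ (by norm_num) (Nat.succ_le_succ hφ.le_apply)
      calc (4 : ℝ) ^ (k + 1) • ∑ i ∈ Finset.range (k + 1), v i
          ≤ (4 : ℝ) ^ (k + 1) • ∑ j ∈ Finset.range (φ k + 1), |x j| := by gcongr
        _ ≤ _ := smul_le_smul_of_nonneg_right h2 (Finset.sum_nonneg fun j _ => abs_nonneg _)
  set w : ℕ → E := fun k =>
    (v k - (4 : ℝ) ^ k • ∑ i ∈ Finset.range k, v i - (1 / 2 : ℝ) ^ k • u)⁺ with hw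
  have hw0 : ∀ k, 0 ≤ w k := fun k => posPart_nonneg _
  have hwd : IsDisjointSeq w := by
    refine isDisjointSeq_posPart_sub_sum (a := fun k => 4 ^ k) (b := fun k => (1 / 2) ^ k)
      (r := fun k => 2 ^ k) hu0 hv0 (fun _ => by positivity) (fun _ => by positivity)
      (fun _ => by positivity) hvu fun i k hik => ?_
    have h1 : (2 : ℝ) ^ i ≤ 2 ^ k := pow_le_pow_right₀ (by norm_num) hik.le
    calc (2 : ℝ) ^ k / (1 / 2) ^ i = 2 ^ k * 2 ^ i := by
          rw [one_div, inv_pow, div_inv_eq_mul]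
      _ ≤ 2 ^ k * 2 ^ k := by gcongr
      _ = 4 ^ k := by rw [← mul_pow]; norm_num
  have hwv : ∀ k, w k ≤ v k := fun k => by
    refine sup_le ((sub_le_self _ ?_).trans (sub_le_self _ ?_)) (hv0 k)
    · exact smul_nonneg (by positivity) hu0
    · exact smul_nonneg (by positivity) (Finset.sum_nonneg fun i _ => hv0 i)
  choose z hzw hz using fun k => exists_abs_le_lt_apply (f (φ k)) (hw0 k)
    (by positivity : 0 < ε / 8)
  have hzd : IsDisjointSeq z := hwd.of_abs_le fun k => by
    rw [abs_of_nonneg (hw0 k)]; exact hzw k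
  have hzp : IsWeaklyPSummable p z :=
    (hx.comp_injective hφ.injective).of_disjoint_of_abs_le hp hzd fun k =>
      (hzw k).trans (hwv k)
  have hlim : Tendsto (fun k => f (φ k) (z k)) atTop (𝓝 0) := by
    have h1 := h z hzd hzp _ (hf.comp_strictMono hφ)
    rw [Metric.tendstoUniformlyOn_iff] at h1
    refine Metric.tendsto_nhds.2 fun δ hδ => ?_
    filter_upwards [h1 δ hδ] with k hk
    rw [dist_comm]
    exact hk (z k) ⟨k, rfl⟩
  have hpow : Tendsto (fun k : ℕ => (1 / 2 : ℝ) ^ k * (C * ‖u‖)) atTop (𝓝 0) := by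
    simpa using (tendsto_pow_atTop_nhds_zero_of_lt_one (r := (1 / 2 : ℝ)) (by norm_num)
      (by norm_num)).mul_const (C * ‖u‖)
  have hlow : ∀ k, ε / 2 ≤ f (φ k) (z k) + (1 / 2 : ℝ) ^ k * (C * ‖u‖) := fun k => by
    have h1 : |f (φ k)| (v k - (4 : ℝ) ^ k • ∑ i ∈ Finset.range k, v i - (1 / 2 : ℝ) ^ k • u) ≤
        |f (φ k)| (w k) := apply_mono (abs_nonneg _) (le_posPart _)
    rw [map_sub, map_sub, map_smul |f (φ k)| _ u, smul_eq_mul] at h1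
    have h2 : |f (φ k)| u ≤ C * ‖u‖ := (abs_apply_le_norm_mul _ hu0).trans
      (mul_le_mul_of_nonneg_right (hfC _) (norm_nonneg u))
    have h3 : (1 / 2 : ℝ) ^ k * |f (φ k)| u ≤ (1 / 2 : ℝ) ^ k * (C * ‖u‖) := by gcongr
    have h4 : ε ≤ |f (φ k)| (v k) := (hle (φ k)).trans (abs_apply_le _ _)
    linarith [hz k, hsmall k]
  have := ge_of_tendsto' (hlim.add hpow) hlow
  linarith

/-- Points of `A` witnessing non-uniform convergence have a subsequence weakly `p`-convergent to
some `c`. The functionals vanish in the limit on the differences and, being weak* null, at `c`. -/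
theorem HasDisjointDPStar.hasPWeakDPStar (hE : IsSigmaDedekindComplete E) {p : ℝ} (hp : 1 < p)
    (h : HasDisjointDPStar E p) : HasPWeakDPStar E p := by
  intro A hA
  refine ⟨hA.isBounded (by linarith), fun f hd hf => ?_⟩
  by_contra hcon
  obtain ⟨ε, hε, φ, hφ, a, ha⟩ := exists_strictMono_le_of_not_tendstoUniformlyOn hcon
  obtain ⟨c, -, ψ, hψ, hs⟩ := hA a fun n => (ha n).1
  have hφψ := hφ.comp hψ
  have h1 : Tendsto (fun k => f (φ (ψ k)) (a (ψ k) - c)) atTop (𝓝 0) :=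
    tendsto_zero_of_forall_subseq fun δ hδ χ hχ =>
      h.not_forall_le_abs_apply hE hp (f := fun k => f (φ (ψ (χ k))))
        (hd.comp_injective (hφψ.comp hχ).injective)
        (hf.comp_strictMono (hφψ.comp hχ)) (hs.comp_injective hχ.injective) hδ
  have h2 := h1.add (isWeakStarNull_iff.1 (hf.comp_strictMono hφψ) c)
  simp only [Function.comp_apply, ← map_add, sub_add_cancel, add_zero] at h2
  have h3 := ge_of_tendsto' h2.abs fun k => (ha (ψ k)).2
  rw [abs_zero] at h3
  linarith

end Main

theorem theorem3p7 {E : Type*} [NormedAddCommGroup E] [NormedSpace ℝ E] [CompleteSpace E]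
    [Lattice E] [IsOrderedAddMonoid E] [IsOrderedModule ℝ E] [HasSolidNorm E]
    (hE : IsSigmaDedekindComplete E) (p : ℝ) (hp : 1 ≤ p) :
    (HasPWeakDPStar E p → HasDisjointDPStar E p) ∧
      (2 ≤ p → (HasPWeakDPStar E p ↔ HasDisjointDPStar E p)) :=
  ⟨fun h => h.hasDisjointDPStar hE (by linarith), fun h2 =>
    ⟨fun h => h.hasDisjointDPStar hE (by linarith), fun h => h.hasPWeakDPStar hE (by linarith)⟩⟩
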